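/- Let $\Gamma$ be a group, $R$ a commutative ring with unity, and $\mathcal H$ a set of subgroups of $\Gamma$ that is closed under conjugation. For a subgroup $H\le\Gamma$, the $\mathcal H$-length of $H$ is the supremum of the integers $s\ge 0$ for which there is a chain of subgroups $H_0<H_1<\dots<H_s\le H$ with all $H_i\in\mathcal H$. Assume that the $\mathcal H$-lengths of the subgroups $H\in\mathcal H$ are bounded by a common integer. A Bredon contramodule for $\mathcal H$ is a contravariant functor to $R$-modules from the orbit category, whose objects are the transitive $\Gamma$-sets $\Gamma/H$ with $H\in\mathcal H$ and whose morphisms are the $\Gamma$-maps. Let $\operatorname{cd}_{\mathcal H}\Gamma$ be the minimal length of a projective resolution, in the abelian category of Bredon contramodules, of the constant functor $\underline R$ with value $R$. For $H\in\mathcal H$ let $WH=N_\Gamma(H)/H$ act by conjugation on the poset $\mathcal H_H=\{K\in\mathcal H: H<K\}$. Let $\mathcal H_{H\bullet}$ be the simplicial chain complex over $R$ of its geometric realization (in degree $n$ it is free over $R$ on the chains $K_0<\dots<K_n$ in $\mathcal H_H$), let $\widetilde{\mathcal H}_{H\bullet}$ be the augmented complex $\mathcal H_{H\bullet}\to R$,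 and let $\Sigma\widetilde{\mathcal H}_{H\bullet}$ be its suspension, which has $R$ in degree $0$ and $\mathcal H_{H,n-1}$ in each degree $n\ge 1$. For a complex $C_\bullet$ of $R[WH]$-modules concentrated in degrees $\ge 0$, let $\operatorname{pd}_{WH}C_\bullet$ be the minimal length of a complex $P_\bullet$ of projective $R[WH]$-modules, concentrated in degrees $\ge 0$, that admits a quasi-isomorphism $P_\bullet\to C_\bullet$. The length of a complex is the supremum, in $\{-\infty\}\cup\mathbb N\cup\{\infty\}$, of the degrees in which it is nonzero; it is $-\infty$ for the zero complex. Then, in $\{-\infty\}\cup\mathbb N\cup\{\infty\}$, $$\operatorname{cd}_{\mathcal H}\Gamma=\max_{H\in\mathcal H}\operatorname{pd}_{WH}\Sigma\widetilde{\mathcal H}_{H\bullet},$$ where $\max$ means the supremum (which is $\infty$ if the values are unbounded, and $-\infty$ if $\mathcal H$ is empty). -/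

import Mathlib

open CategoryTheory

universe u

noncomputable section

namespace BredonDim

/-! ### Length of complexes and projective dimension of complexes -/

section Homological

variable {A : Type*} [Category A] [Abelian A]

/-- The length of a nonnegative chain complex: the supremum of the degrees in which it is nonzero.
It is `⊥` (that is, `-∞`) for the zero complex and `⊤` (that is, `∞`) if there are nonzero terms in
arbitrarily high degrees. -/
def complexLength (C : ChainComplex A ℕ) : WithBot ℕ∞ :=
  ⨆ (n : ℕ) (_ : ¬ Limits.IsZero (C.X n)), (n : WithBot ℕ∞)

/-- A projective resolution of a nonnegative chain complex `C`: a nonnegative chain complex of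
projective objects with a quasi-isomorphism to `C`. -/
structure ComplexResolution (C : ChainComplex A ℕ) where
  complex : ChainComplex A ℕ
  projective : ∀ n, Projective (complex.X n)
  π : complex ⟶ C
  quasiIso : QuasiIso π

/-- The projective dimension of a nonnegative chain complex: the least length of a projective
resolution of it. -/
def complexProjDim (C : ChainComplex A ℕ) : WithBot ℕ∞ :=
  ⨅ P : ComplexResolution C, complexLength P.complex

end Homological

/-! ### Classes of subgroups and the Bredon cohomological dimension -/

/-- A class of subgroups of `Γ`: a set of subgroups which is closed under conjugation. -/
structure SubgroupFamily (Γ : Type u) [Group Γ] where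
  carrier : Set (Subgroup Γ)
  conj_mem : ∀ (g : Γ) (H : Subgroup Γ), H ∈ carrier →
    H.map (MulAut.conj g).toMonoidHom ∈ carrier

variable {Γ : Type u} [Group Γ]

/-- The `𝓗`-length of a subgroup `H`: the supremum of the `s` for which there is a chain
`H₀ < H₁ < ⋯ < Hₛ ≤ H` with all `Hᵢ` in `𝓗`. -/
def subgroupLength (𝓗 : SubgroupFamily Γ) (H : Subgroup Γ) : WithBot ℕ∞ :=
  Order.krullDim {K : Subgroup Γ // K ∈ 𝓗.carrier ∧ K ≤ H}

/-- The orbit category of `Γ` for the class `𝓗`. An object is a subgroup `H` in `𝓗`, and stands for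
the transitive `Γ`-set `Γ ⧸ H`; the morphisms are the `Γ`-maps. -/
structure OrbitCat (𝓗 : SubgroupFamily Γ) where
  stab : Subgroup Γ
  mem : stab ∈ 𝓗.carrier

instance (𝓗 : SubgroupFamily Γ) : Category (OrbitCat 𝓗) where
  Hom H K := (Γ ⧸ H.stab) →[Γ] (Γ ⧸ K.stab)
  id H := MulActionHom.id Γ
  comp f g := MulActionHom.comp g f

/-- Bredon contramodules for `𝓗` over `R`: contravariant functors from the orbit category to
`R`-modules. -/
abbrev Contramodule (R : Type u) [CommRing R] (𝓗 : SubgroupFamily Γ) :=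
  (OrbitCat 𝓗)ᵒᵖ ⥤ ModuleCat.{u} R

/-- The trivial contramodule: the constant functor with value `R`. -/
def trivialContramodule (R : Type u) [CommRing R] (𝓗 : SubgroupFamily Γ) : Contramodule R 𝓗 :=
  (Functor.const _).obj (ModuleCat.of R R)

/-- The Bredon cohomological dimension of `Γ` for `𝓗` over `R`: the least length of a projective
resolution of the trivial contramodule. -/
def bredonCohDim (R : Type u) [CommRing R] (𝓗 : SubgroupFamily Γ) : WithBot ℕ∞ :=
  ⨅ P : ProjectiveResolution (trivialContramodule R 𝓗), complexLength P.complex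

/-! ### The chain complex of a poset with a group action -/

section PosetComplex

variable {P : Type u} [PartialOrder P]

/-- The strict chains `x₀ < ⋯ < xₙ` in `P`, that is, the `n`-simplices of the geometric
realization of `P`. -/
abbrev Simplices (P : Type u) [PartialOrder P] (n : ℕ) := Fin (n + 1) ↪o P

/-- The `i`-th face of a chain: leave out the `i`-th element. -/
def face {n : ℕ} (i : Fin (n + 2)) (c : Simplices P (n + 1)) : Simplices P n :=
  (Fin.succAboveOrderEmb i).trans c

/-- An automorphism of the poset acts on chains elementwise. -/
def actSimplex {n : ℕ} (e : P ≃o P) (c : Simplices P n) : Simplices P n :=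
  c.trans e.toOrderEmbedding

lemma face_actSimplex {n : ℕ} (i : Fin (n + 2)) (e : P ≃o P) (c : Simplices P (n + 1)) :
    face i (actSimplex e c) = actSimplex e (face i c) := rfl

variable (R : Type u) [CommRing R] {G : Type u} [Group G]

/-- The permutation representation of `G` over `R` on the `n`-simplices of a `G`-poset `P`, where
the action of `G` on `P` is given by `ρ`. -/
def simplexRep (ρ : G →* (P ≃o P)) (n : ℕ) : Representation R G (Simplices P n →₀ R) where
  toFun g := Finsupp.lmapDomain R R (actSimplex (ρ g))
  map_one' := by
    ext c : 2
    simp only [map_one, LinearMap.comp_apply, Finsupp.lsingle_apply, Finsupp.lmapDomain_apply,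
      Finsupp.mapDomain_single]
    rfl
  map_mul' g h := by
    ext c : 2
    simp only [map_mul, LinearMap.comp_apply, Finsupp.lsingle_apply, Finsupp.lmapDomain_apply,
      Finsupp.mapDomain_single, Module.End.mul_apply]
    rfl

/-- The simplicial boundary `c ↦ ∑ i, (-1)^i • (i-th face of c)`. -/
def boundaryLin (P : Type u) [PartialOrder P] (n : ℕ) :
    (Simplices P (n + 1) →₀ R) →ₗ[R] (Simplices P n →₀ R) :=
  Finsupp.linearCombination R
    fun c => ∑ i : Fin (n + 2), (-1 : R) ^ (i : ℕ) • Finsupp.single (face i c) 1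

/-- The augmentation, sending every vertex to `1`. -/
def augmentationLin (P : Type u) [PartialOrder P] : (Simplices P 0 →₀ R) →ₗ[R] R :=
  Finsupp.linearCombination R fun _ => 1

lemma boundaryLin_single {n : ℕ} (c : Simplices P (n + 1)) :
    boundaryLin R P n (Finsupp.single c 1) =
      ∑ i : Fin (n + 2), (-1 : R) ^ (i : ℕ) • Finsupp.single (face i c) 1 := by
  simp [boundaryLin]

lemma face_face {n : ℕ} (i : Fin (n + 2)) (j : Fin (n + 3)) (h : (j : ℕ) ≤ i)
    (c : Simplices P (n + 2)) :
    face i (face j c) =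
      face (Fin.castLT j (lt_of_le_of_lt h i.is_lt)) (face i.succ c) := by
  refine RelEmbedding.ext fun k => ?_
  simp only [face, RelEmbedding.trans_apply, Fin.succAboveOrderEmb_apply]
  congr 1
  ext
  simp only [Fin.succAbove, Fin.lt_def, Fin.val_castSucc, Fin.val_castLT, Fin.val_succ]
  split_ifs <;> simp at * <;> omega

lemma boundaryLin_comp (n : ℕ) : boundaryLin R P n ∘ₗ boundaryLin R P (n + 1) = 0 := by
  ext c : 2
  simp only [LinearMap.comp_apply, Finsupp.lsingle_apply, boundaryLin_single, map_sum, map_smul,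
    Finset.smul_sum, smul_smul, LinearMap.zero_apply]
  rw [← Finset.sum_product']
  let S : Finset (Fin (n + 3) × Fin (n + 2)) := {ji | (ji.1 : ℕ) ≤ (ji.2 : ℕ)}
  rw [Finset.univ_product_univ, ← Finset.sum_add_sum_compl S, ← eq_neg_iff_add_eq_zero,
    ← Finset.sum_neg_distrib]
  refine Finset.sum_bij
    (fun ji hji => (ji.2.succ,
      Fin.castLT ji.1 (lt_of_le_of_lt (Finset.mem_filter.mp hji).right ji.2.is_lt))) ?_ ?_ ?_ ?_
  · rintro ⟨j, i⟩ h
    simp only [S, Finset.compl_filter, Finset.mem_filter_univ, Fin.val_succ,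
      Fin.val_castLT] at h ⊢
    omega
  · rintro ⟨j, i⟩ h ⟨j', i'⟩ h' e
    simp only [Prod.mk.injEq, Fin.ext_iff, Fin.val_succ, Fin.val_castLT] at e ⊢
    omega
  · rintro ⟨j, i⟩ h
    simp only [S, Finset.compl_filter, Finset.mem_filter_univ, not_le] at h
    refine ⟨(i.castSucc, j.pred ?_), ?_, ?_⟩
    · rintro rfl
      simp at h
    · simp only [S, Finset.mem_filter_univ, Fin.val_castSucc, Fin.val_pred]
      omega
    · simp
  · rintro ⟨j, i⟩ h
    have h' : (j : ℕ) ≤ i := (Finset.mem_filter.mp h).right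
    simp only [Fin.val_succ, Fin.val_castLT]
    rw [face_face i j h' c, ← neg_smul]
    congr 1
    ring

lemma augmentationLin_comp : augmentationLin R P ∘ₗ boundaryLin R P 0 = 0 := by
  ext c : 2
  simp [boundaryLin_single, augmentationLin, Fin.sum_univ_two]

lemma boundaryLin_equivariant (ρ : G →* (P ≃o P)) (n : ℕ) (g : G) :
    boundaryLin R P n ∘ₗ simplexRep R ρ (n + 1) g = simplexRep R ρ n g ∘ₗ boundaryLin R P n := by
  ext c : 2
  simp [boundaryLin_single, simplexRep, face_actSimplex]

lemma augmentationLin_equivariant (ρ : G →* (P ≃o P)) (g : G) :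
    augmentationLin R P ∘ₗ simplexRep R ρ 0 g =
      Representation.trivial R G R g ∘ₗ augmentationLin R P := by
  ext c : 2
  simp [augmentationLin, simplexRep]

/-- The boundary as a morphism of `G`-modules over `R`. -/
def boundary (ρ : G →* (P ≃o P)) (n : ℕ) :
    Rep.of (simplexRep R ρ (n + 1)) ⟶ Rep.of (simplexRep R ρ n) :=
  Rep.ofHom ⟨boundaryLin R P n, boundaryLin_equivariant R ρ n⟩

/-- The augmentation as a morphism of `G`-modules over `R`. -/
def augmentation (ρ : G →* (P ≃o P)) :
    Rep.of (simplexRep R ρ 0) ⟶ Rep.of (Representation.trivial R G R) :=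
  Rep.ofHom ⟨augmentationLin R P, augmentationLin_equivariant R ρ⟩

/-- The chain complex of `G`-modules over `R` of the geometric realization of a `G`-poset. -/
def posetComplex (ρ : G →* (P ≃o P)) : ChainComplex (Rep.{u} R G) ℕ :=
  ChainComplex.of (fun n => Rep.of (simplexRep R ρ n)) (boundary R ρ) fun n => by
    apply Rep.hom_ext
    apply Representation.IntertwiningMap.ext
    exact boundaryLin_comp R n

/-- The suspension of the augmented chain complex of a `G`-poset: it has the trivial module `R` in
degree `0` and the `n`-simplices in degree `n + 1`. -/
def suspendedAugmentedComplex (ρ : G →* (P ≃o P)) : ChainComplex (Rep.{u} R G) ℕ :=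
  (posetComplex R ρ).augment (augmentation R ρ) <| by
    apply Rep.hom_ext
    apply Representation.IntertwiningMap.ext
    exact augmentationLin_comp R

end PosetComplex

/-! ### Weyl groups and the posets of larger subgroups in the class -/

/-- The Weyl group `WH = N_Γ(H) / H`. -/
abbrev Weyl (H : Subgroup Γ) : Type u :=
  Subgroup.normalizer (H : Set Γ) ⧸ H.subgroupOf (Subgroup.normalizer (H : Set Γ))

/-- The poset of the `K` in `𝓗` with `H < K`, ordered by inclusion. -/
abbrev Above (𝓗 : SubgroupFamily Γ) (H : Subgroup Γ) : Type u :=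
  {K : Subgroup Γ // K ∈ 𝓗.carrier ∧ H < K}

lemma map_conj_mul (g h : Γ) (K : Subgroup Γ) :
    K.map (MulAut.conj (g * h)).toMonoidHom =
      (K.map (MulAut.conj h).toMonoidHom).map (MulAut.conj g).toMonoidHom := by
  rw [Subgroup.map_map, map_mul]
  rfl

lemma map_conj_one (K : Subgroup Γ) : K.map (MulAut.conj (1 : Γ)).toMonoidHom = K := by
  rw [map_one]
  exact Subgroup.map_id K

lemma map_conj_lt (g : Γ) {K L : Subgroup Γ} (h : K < L) :
    K.map (MulAut.conj g).toMonoidHom < L.map (MulAut.conj g).toMonoidHom :=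
  lt_of_le_not_ge (Subgroup.map_mono h.le) fun h' =>
    h.not_ge ((Subgroup.map_le_map_iff_of_injective (MulAut.conj g).injective).1 h')

/-- The conjugate `n K n⁻¹` of a `K` in `𝓗` with `H < K`, for `n` in the normalizer of `H`. -/
def conjAbove (𝓗 : SubgroupFamily Γ) (H : Subgroup Γ) (n : Subgroup.normalizer (H : Set Γ))
    (K : Above 𝓗 H) : Above 𝓗 H :=
  ⟨K.1.map (MulAut.conj (n : Γ)).toMonoidHom, 𝓗.conj_mem _ _ K.2.1, by
    have h := map_conj_lt (n : Γ) K.2.2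
    have e : H.map (MulAut.conj (n : Γ)).toMonoidHom = H :=
      Subgroup.mem_normalizer_iff_map_conj_eq.1 n.2
    rwa [e] at h⟩

/-- The conjugation action of the normalizer of `H` on the poset of the `K` in `𝓗` with `H < K`. -/
def normalizerAction (𝓗 : SubgroupFamily Γ) (H : Subgroup Γ) :
    Subgroup.normalizer (H : Set Γ) →* (Above 𝓗 H ≃o Above 𝓗 H) where
  toFun n :=
    { toFun := conjAbove 𝓗 H n
      invFun := conjAbove 𝓗 H n⁻¹
      left_inv := fun K => Subtype.ext <| by
        simp only [conjAbove, InvMemClass.coe_inv]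
        rw [← map_conj_mul, inv_mul_cancel, map_conj_one]
      right_inv := fun K => Subtype.ext <| by
        simp only [conjAbove, InvMemClass.coe_inv]
        rw [← map_conj_mul, mul_inv_cancel, map_conj_one]
      map_rel_iff' := fun {K L} =>
        Subgroup.map_le_map_iff_of_injective (MulAut.conj (n : Γ)).injective }
  map_one' := by
    refine RelIso.ext fun K => Subtype.ext ?_
    exact map_conj_one K.1
  map_mul' m n := by
    refine RelIso.ext fun K => Subtype.ext ?_
    exact map_conj_mul (m : Γ) (n : Γ) K.1

/-- The conjugation action of `WH` on the poset of the `K` in `𝓗` with `H < K`. -/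
def weylAction (𝓗 : SubgroupFamily Γ) (H : Subgroup Γ) : Weyl H →* (Above 𝓗 H ≃o Above 𝓗 H) :=
  QuotientGroup.lift _ (normalizerAction 𝓗 H) <| by
    intro n hn
    refine RelIso.ext fun K => Subtype.ext ?_
    have h : (n : Γ) ∈ K.1 := K.2.2.le (Subgroup.mem_subgroupOf.1 hn)
    exact Subgroup.mem_normalizer_iff_map_conj_eq.1 (Subgroup.le_normalizer h)

/-- The complex of `WH`-modules which is the suspension of the augmented chain complex of the poset
of the `K` in `𝓗` with `H < K`. -/
def weylComplex (R : Type u) [CommRing R] (𝓗 : SubgroupFamily Γ) (H : Subgroup Γ) :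
    ChainComplex (Rep.{u} R (Weyl H)) ℕ :=
  suspendedAugmentedComplex R (weylAction 𝓗 H)

end BredonDim

end

/-! Contramodules are compared with modules over the Weyl groups through the functors `topRep R K`,
which send `M` to `M(Γ/K)` modulo its radical, the span of the images of the non-isomorphisms out of
`Γ/K`.

Bounded lengths force every endomorphism in the orbit category to be invertible. Hence radicals are
subfunctors, and an endomorphism with values in the radical is nilpotent, since each application
moves up in a poset of finite height. This Nakayama argument gives `isSplitMono_of_topRep`: a
morphism into a projective contramodule splits as soon as all its tops split over the Weyl groups.
Tops of projectives are projective (`projective_topRep_obj`), because `topRep R K` is left adjoint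
to a coinduction that preserves epimorphisms.

The chains `H ≤ K₀ < ⋯ < Kₘ` in `𝓗` span contramodules that resolve the trivial one, the poset above
`H` having a least element. Modulo radicals only the chains with `K₀ = H` survive, and dropping `H`
identifies the top at `H` with the suspended augmented complex (`weylToTop`). These contramodules
need not be projective, but their restrictions to the poset `𝓗` are, and as an `R`-module the top
depends only on that restriction. So the tops of a projective resolution of the trivial contramodule
form a projective resolution of each Weyl complex (`exists_quasiIso_topRep`), which gives one
inequality.

Conversely, let every Weyl complex have a projective resolution of length less than `N`, and let `P`
be a projective resolution of the trivial contramodule. For `N > 0`, the identity of each `topRep R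
K` of `P` is homotopic to a map that vanishes in degree `N`, so the inclusion of boundaries into
degree `N - 1` splits on tops, hence splits, and `P` can be cut off there. For `N = 0` all tops of
the cokernel of the first differential vanish, hence so does the trivial contramodule. -/

noncomputable section

namespace BredonDim

/-! ### Lifting along quasi-isomorphisms, and truncation of resolutions -/

section Homological

open HomologicalComplex DerivedCategory

variable {A : Type*} [Category A] [Abelian A]

attribute [local instance] HasDerivedCategory.standard in
/-- A morphism from a complex of projectives lifts along a quasi-isomorphism, up to homotopy. -/
lemma exists_lift_quasiIso {P X Y : ChainComplex A ℕ} (hP : ∀ n, Projective (P.X n))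
    (s : X ⟶ Y) [QuasiIso s] (f : P ⟶ Y) :
    ∃ f' : P ⟶ X, Nonempty (Homotopy (f' ≫ s) f) := by
  let e := ComplexShape.embeddingDownNat
  have hs : QuasiIso (extendMap s e) := (quasiIso_extendMap_iff s e).2 inferInstance
  -- Extended to a cochain complex over the integers, `P` is bounded above with projective terms,
  -- hence K-projective: its maps up to homotopy are its maps in the derived category. There `s` is
  -- invertible, and `f` composed with its inverse is the required lift.
  obtain ⟨g, hg⟩ := (CochainComplex.IsKProjective.Qh_map_bijective (P.extend e)
      ((HomotopyCategory.quotient _ _).obj (X.extend e))).surjective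
    ((quotientCompQhIso A).hom.app _ ≫ Q.map (extendMap f e) ≫ inv (Q.map (extendMap s e)) ≫
      (quotientCompQhIso A).inv.app _)
  obtain ⟨g, rfl⟩ := (HomotopyCategory.quotient _ _).map_surjective g
  obtain ⟨f', rfl⟩ := (e.extendFunctor A).map_surjective g
  refine ⟨f', ⟨Homotopy.ofExtend (e := e) (HomotopyCategory.homotopyOfEq _ _ ?_)⟩⟩
  apply (CochainComplex.IsKProjective.Qh_map_bijective (P.extend e)
      ((HomotopyCategory.quotient _ _).obj (Y.extend e))).injective
  have h1 := (quotientCompQhIso A).hom.naturality (extendMap s e)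
  have h2 := (quotientCompQhIso A).hom.naturality (extendMap f e)
  dsimp at h1 h2 hg
  change Qh.map ((HomotopyCategory.quotient _ _).map (extendMap f' e)) = _ at hg
  rw [extendMap_comp, Functor.map_comp, Functor.map_comp, hg]
  rw [← cancel_mono ((quotientCompQhIso A).hom.app _), h2]
  simp only [Category.assoc]
  rw [h1]
  simp

attribute [local instance] HasDerivedCategory.standard in
/-- Morphisms from a complex of projectives are homotopic if they are so after composition with a
quasi-isomorphism. -/
lemma nonempty_homotopy_of_comp_quasiIso {P X Y : ChainComplex A ℕ}
    (hP : ∀ n, Projective (P.X n)) (s : X ⟶ Y) [QuasiIso s] (f g : P ⟶ X)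
    (h : Homotopy (f ≫ s) (g ≫ s)) : Nonempty (Homotopy f g) := by
  let e := ComplexShape.embeddingDownNat
  have hs : QuasiIso (extendMap s e) := (quasiIso_extendMap_iff s e).2 inferInstance
  refine ⟨Homotopy.ofExtend (e := e) (HomotopyCategory.homotopyOfEq _ _ ?_)⟩
  apply (CochainComplex.IsKProjective.Qh_map_bijective (P.extend e)
      ((HomotopyCategory.quotient _ _).obj (X.extend e))).injective
  have h0 := HomotopyCategory.eq_of_homotopy _ _ (h.extend e)
  have h1 := (quotientCompQhIso A).hom.naturality (extendMap s e)
  dsimp at h1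
  rw [← cancel_mono ((quotientCompQhIso A).hom.app _ ≫ Q.map (extendMap s e)), ← h1]
  rw [extendMap_comp, extendMap_comp, Functor.map_comp, Functor.map_comp] at h0
  rw [← Functor.map_comp_assoc, h0, Functor.map_comp_assoc]

/-- If a complex of projectives is quasi-isomorphic to a complex of projectives which is zero in
degree `N`, then its identity is homotopic to a map which is zero in degree `N`. -/
lemma exists_homotopy_id_of_isZero {W P Q : ChainComplex A ℕ} (hP : ∀ n, Projective (P.X n))
    (hQ : ∀ n, Projective (Q.X n)) (s : P ⟶ W) [QuasiIso s] (q : Q ⟶ W) [QuasiIso q] (N : ℕ)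
    (hN : Limits.IsZero (Q.X N)) :
    ∃ φ : P ⟶ P, φ.f N = 0 ∧ Nonempty (Homotopy (𝟙 P) φ) := by
  obtain ⟨f, ⟨hf⟩⟩ := exists_lift_quasiIso hP q s
  obtain ⟨g, ⟨hg⟩⟩ := exists_lift_quasiIso hQ s q
  -- The composite passes through `Q`, so it vanishes in degree `N`; composed with `s` it is
  -- homotopic to `s`, as is the identity.
  refine ⟨f ≫ g, ?_, nonempty_homotopy_of_comp_quasiIso hP s _ _ ?_⟩
  · rw [comp_f, hN.eq_of_tgt (f.f N) 0, Limits.zero_comp]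
  · refine Homotopy.symm (Homotopy.trans ?_ (hf.trans (Homotopy.ofEq (by simp))))
    exact (Homotopy.ofEq (by simp)).trans (hg.compLeft f)

/-- The embedding of the degrees below `N` into all degrees. -/
def belowEmbedding (N : ℕ) :
    ComplexShape.Embedding
      ({ Rel := fun i j : Fin N => (j : ℕ) + 1 = i
         next_eq := fun h h' => Fin.ext (by omega)
         prev_eq := fun h h' => Fin.ext (by omega) } : ComplexShape (Fin N))
      (ComplexShape.down ℕ) where
  f i := i
  injective_f := Fin.val_injective
  rel h := h

/-- Differentials lower the degree, so the degrees below `N` are closed under successors for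
`ComplexShape.down ℕ`. Hence `truncGE` discards the high degrees and puts `opcycles` in degree `N -
1`. -/
instance (N : ℕ) : (belowEmbedding N).IsTruncGE where
  rel' _ _ h := h
  mem_next {j k} h := ⟨⟨k, by have := j.2; simp [belowEmbedding] at h; omega⟩, rfl⟩

/-- Strict bounds are used throughout so that `N = 0` expresses length `-∞`. -/
lemma complexLength_lt_of_isZero {C : ChainComplex A ℕ} {N : ℕ}
    (h : ∀ n, N ≤ n → Limits.IsZero (C.X n)) : complexLength C < N := by
  rw [complexLength]
  rcases N with _ | N
  · refine lt_of_le_of_lt (b := ⊥) ?_ (WithBot.bot_lt_coe _)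
    exact iSup₂_le fun n hn => absurd (h n (Nat.zero_le _)) hn
  · refine lt_of_le_of_lt (b := ((N : ℕ∞) : WithBot ℕ∞)) ?_ (by exact_mod_cast Nat.lt_succ_self N)
    refine iSup₂_le fun n hn => ?_
    have : n ≤ N := by
      by_contra h'
      exact hn (h n (by omega))
    exact_mod_cast this

lemma isZero_of_complexLength_lt {C : ChainComplex A ℕ} {N : ℕ} (h : complexLength C < N) :
    Limits.IsZero (C.X N) := by
  by_contra h'
  refine absurd h (not_lt.2 ?_)
  exact le_iSup₂_of_le (f := fun (n : ℕ) (_ : ¬ Limits.IsZero (C.X n)) => (n : WithBot ℕ∞)) N h'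
    le_rfl

/-- A projective resolution can be cut off in degree `N` if its syzygy there is projective. -/
lemma exists_projectiveResolution_complexLength_lt {Z : A} (P : ProjectiveResolution Z) (N : ℕ)
    (h : Projective (P.complex.opcycles N)) :
    ∃ P' : ProjectiveResolution Z, complexLength P'.complex < (N + 1 : ℕ) := by
  let e := belowEmbedding (N + 1)
  have hs : ((ChainComplex.single₀ A).obj Z).IsStrictlySupported e := by
    constructor
    intro i hi
    refine HomologicalComplex.isZero_single_obj_X _ _ _ _ ?_
    rintro rfl
    exact hi ⟨0, Nat.succ_pos _⟩ rfl
  have hP : P.complex.IsSupported e :=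
    (isSupported_iff_of_quasiIso P.π e).2 inferInstance
  have h1 : QuasiIso (P.complex.πTruncGE e) :=
    (quasiIso_πTruncGE_iff_isSupported _ _).2 hP
  have h2 : IsIso (((ChainComplex.single₀ A).obj Z).πTruncGE e) := inferInstance
  refine ⟨⟨P.complex.truncGE e, ?_, truncGEMap P.π e ≫ inv (πTruncGE _ e), ?_⟩, ?_⟩
  · intro n
    by_cases hn : n < N + 1
    -- Only degree `N` is a boundary degree; there the truncation has `opcycles N`, and below it is
    -- unchanged.
    · by_cases hb : e.BoundaryGE ⟨n, hn⟩
      · have : n = N := by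
          by_contra h'
          exact hb.2 ⟨n + 1, by omega⟩ rfl
        subst this
        exact Projective.of_iso (P.complex.truncGEXIsoOpcycles e (i := ⟨n, hn⟩) rfl hb).symm h
      · exact Projective.of_iso (P.complex.truncGEXIso e (i := ⟨n, hn⟩) rfl hb).symm
          (P.projective n)
    · refine Limits.IsZero.projective ?_
      exact isZero_X_of_isStrictlySupported _ e _ fun i hi => hn (hi ▸ i.2)
  · have : QuasiIso (truncGEMap P.π e) := by
      rw [quasiIso_truncGEMap_iff]
      intro i i' _
      infer_instance
    infer_instance
  · refine complexLength_lt_of_isZero fun n hn => ?_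
    exact isZero_X_of_isStrictlySupported _ e _ fun i hi => (not_lt.2 hn) (hi ▸ i.2)

end Homological

/-! ### Morphisms of the orbit category and the EI property -/

section Orbit

variable {Γ : Type u} [Group Γ] {𝓗 : SubgroupFamily Γ}

/-- The `Γ`-map `Γ ⧸ H → Γ ⧸ L` which sends `aH` to `agL`. -/
def orbitHom {H L : OrbitCat 𝓗} (g : Γ) (h : ∀ x ∈ H.stab, g⁻¹ * x * g ∈ L.stab) : H ⟶ L :=
  show (Γ ⧸ H.stab) →[Γ] (Γ ⧸ L.stab) from
  { toFun := Quotient.map' (· * g) fun a b hab => by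
      rw [QuotientGroup.leftRel_apply] at hab ⊢
      have := h _ hab
      simpa [mul_assoc] using this
    map_smul' := fun a b => by
      induction b using QuotientGroup.induction_on with
      | _ b => exact congrArg _ (mul_assoc a b g) }

/-- The underlying map of a morphism of the orbit category. -/
def toMap {H L : OrbitCat 𝓗} (f : H ⟶ L) : (Γ ⧸ H.stab) →[Γ] (Γ ⧸ L.stab) := f

lemma toMap_comp {H L K : OrbitCat 𝓗} (f : H ⟶ L) (f' : L ⟶ K) (x : Γ ⧸ H.stab) :
    toMap (f ≫ f') x = toMap f' (toMap f x) := rfl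

lemma toMap_id (H : OrbitCat 𝓗) (x : Γ ⧸ H.stab) : toMap (𝟙 H) x = x := rfl

lemma toMap_orbitHom {H L : OrbitCat 𝓗} (g : Γ) (h : ∀ x ∈ H.stab, g⁻¹ * x * g ∈ L.stab) (a : Γ) :
    toMap (orbitHom g h) (a : Γ ⧸ H.stab) = ((a * g : Γ) : Γ ⧸ L.stab) := rfl

lemma orbitHom_ext {H L : OrbitCat 𝓗} {f f' : H ⟶ L}
    (h : toMap f ((1 : Γ) : Γ ⧸ H.stab) = toMap f' ((1 : Γ) : Γ ⧸ H.stab)) : f = f' := by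
  refine MulActionHom.ext (f := toMap f) (g := toMap f') fun x => ?_
  induction x using QuotientGroup.induction_on with
  | _ a =>
    have e : (a : Γ ⧸ H.stab) = a • ((1 : Γ) : Γ ⧸ H.stab) := by
      rw [← QuotientGroup.mk_mul_of_mem a (one_mem _)]
      rfl
    rw [e, map_smul, map_smul, h]

lemma orbitHom_eq {H L : OrbitCat 𝓗} {g g' : Γ} (h : ∀ x ∈ H.stab, g⁻¹ * x * g ∈ L.stab)
    (h' : ∀ x ∈ H.stab, g'⁻¹ * x * g' ∈ L.stab) (e : g⁻¹ * g' ∈ L.stab) :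
    orbitHom g h = orbitHom g' h' := by
  apply orbitHom_ext
  rw [toMap_orbitHom, toMap_orbitHom, QuotientGroup.eq]
  simpa using e

lemma toMap_one_mem {H L : OrbitCat 𝓗} (f : H ⟶ L) (g : Γ)
    (hg : toMap f ((1 : Γ) : Γ ⧸ H.stab) = (g : Γ ⧸ L.stab)) :
    ∀ x ∈ H.stab, g⁻¹ * x * g ∈ L.stab := by
  intro x hx
  have e : x • ((1 : Γ) : Γ ⧸ H.stab) = ((1 : Γ) : Γ ⧸ H.stab) := by
    change ((x * 1 : Γ) : Γ ⧸ H.stab) = _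
    rw [QuotientGroup.eq]
    simpa using hx
  have e' : x • toMap f ((1 : Γ) : Γ ⧸ H.stab) = toMap f ((1 : Γ) : Γ ⧸ H.stab) := by
    rw [← map_smul, e]
  rw [hg] at e'
  have := QuotientGroup.eq.1 e'.symm
  simpa [mul_assoc] using this

lemma exists_orbitHom {H L : OrbitCat 𝓗} (f : H ⟶ L) :
    ∃ (g : Γ) (h : ∀ x ∈ H.stab, g⁻¹ * x * g ∈ L.stab), f = orbitHom g h := by
  obtain ⟨g, hg⟩ := QuotientGroup.mk_surjective (toMap f ((1 : Γ) : Γ ⧸ H.stab))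
  refine ⟨g, toMap_one_mem f g hg.symm, orbitHom_ext ?_⟩
  exact hg.symm.trans (by rw [toMap_orbitHom, one_mul])

lemma orbitHom_comp {H L K : OrbitCat 𝓗} (g g' : Γ) (h : ∀ x ∈ H.stab, g⁻¹ * x * g ∈ L.stab)
    (h' : ∀ x ∈ L.stab, g'⁻¹ * x * g' ∈ K.stab)
    (h'' : ∀ x ∈ H.stab, (g * g')⁻¹ * x * (g * g') ∈ K.stab) :
    orbitHom g h ≫ orbitHom g' h' = orbitHom (g * g') h'' := by
  apply orbitHom_ext
  rw [toMap_comp, toMap_orbitHom, toMap_orbitHom, toMap_orbitHom, mul_assoc]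

lemma orbitHom_one (H : OrbitCat 𝓗) (h : ∀ x ∈ H.stab, (1 : Γ)⁻¹ * x * 1 ∈ H.stab) :
    orbitHom 1 h = 𝟙 H := by
  apply orbitHom_ext
  rw [toMap_orbitHom, toMap_id, one_mul]

/-- Together with `h` the condition reads `H = g L g⁻¹`. If `g'` represents the inverse, then `g g'`
lies in `H`, and conjugation by it brings `x` back into `H`. -/
lemma isIso_orbitHom_iff {H L : OrbitCat 𝓗} (g : Γ) (h : ∀ x ∈ H.stab, g⁻¹ * x * g ∈ L.stab) :
    IsIso (orbitHom g h) ↔ ∀ x, g⁻¹ * x * g ∈ L.stab → x ∈ H.stab := by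
  constructor
  · intro hi x hx
    obtain ⟨g', h', e⟩ := exists_orbitHom (inv (orbitHom g h))
    have e1 : toMap (orbitHom g h ≫ inv (orbitHom g h)) ((1 : Γ) : Γ ⧸ H.stab) =
        ((1 : Γ) : Γ ⧸ H.stab) := by rw [IsIso.hom_inv_id, toMap_id]
    rw [e, toMap_comp, toMap_orbitHom, toMap_orbitHom, one_mul, eq_comm, QuotientGroup.eq] at e1
    have e2 : g * g' ∈ H.stab := by simpa using e1
    have e3 := h' _ hx
    have e4 := mul_mem (mul_mem e2 e3) (inv_mem e2)
    simpa [mul_assoc] using e4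
  · intro h'
    refine ⟨orbitHom g⁻¹ (fun x hx => h' _ (by simpa [mul_assoc] using hx)), ?_, ?_⟩
    · rw [orbitHom_comp _ _ _ _ (by simp), orbitHom_eq _ (g' := 1) (by simp) (by simp),
        orbitHom_one]
    · rw [orbitHom_comp _ _ _ _ (by simp), orbitHom_eq _ (g' := 1) (by simp) (by simp),
        orbitHom_one]

variable (𝓗) in
/-- The poset of the subgroups in `𝓗`. -/
abbrev Members : Type u := {K : Subgroup Γ // K ∈ 𝓗.carrier}

/-- An element of the class as an object of the orbit category. -/
abbrev Members.toOrbit (K : Members 𝓗) : OrbitCat 𝓗 := ⟨K.1, K.2⟩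

variable (𝓗) in
/-- The functor from the poset `𝓗` to the orbit category which sends `K ≤ L` to the projection
`Γ ⧸ K → Γ ⧸ L`. -/
def orbitIncl : Members 𝓗 ⥤ OrbitCat 𝓗 where
  obj K := K.toOrbit
  map {K L} f := orbitHom 1 fun x hx => by simpa using leOfHom f hx
  map_id K := orbitHom_one _ _
  map_comp f g := by
    rw [orbitHom_comp _ _ _ _ (by
      intro x hx
      simpa using leOfHom (f ≫ g) hx)]
    exact orbitHom_eq _ _ (by simp)

/-- The projection `Γ ⧸ K → Γ ⧸ L` for `K ≤ L`. -/
abbrev incl {K L : Members 𝓗} (h : K ≤ L) : K.toOrbit ⟶ L.toOrbit := (orbitIncl 𝓗).map (homOfLE h)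

lemma incl_eq {K L : Members 𝓗} (h : K ≤ L) :
    incl h = orbitHom 1 (fun x hx => by simpa using h hx) := rfl

lemma not_isIso_incl {K L : Members 𝓗} (h : K < L) : ¬ IsIso (incl h.le) := by
  rw [incl_eq, isIso_orbitHom_iff]
  intro h'
  exact h.not_ge fun x hx => h' x (by simpa using hx)

/-- The conjugate `g L g⁻¹` of a subgroup in the class. -/
def Members.conj (g : Γ) (L : Members 𝓗) : Members 𝓗 :=
  ⟨L.1.map (MulAut.conj g).toMonoidHom, 𝓗.conj_mem g _ L.2⟩

lemma Members.mem_conj {g : Γ} {L : Members 𝓗} {x : Γ} :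
    x ∈ (L.conj g).1 ↔ g⁻¹ * x * g ∈ L.1 := by
  rw [Members.conj, Subgroup.mem_map_equiv]
  simp

/-- Every morphism of the orbit category is a projection followed by an isomorphism. -/
lemma exists_incl_comp_iso (K : Members 𝓗) {L : OrbitCat 𝓗} (f : K.toOrbit ⟶ L) :
    ∃ (L' : Members 𝓗) (h : K ≤ L') (e : L'.toOrbit ⟶ L), IsIso e ∧ f = incl h ≫ e := by
  obtain ⟨g, hg, rfl⟩ := exists_orbitHom f
  have hm {x : Γ} := Members.mem_conj (𝓗 := 𝓗) (g := g) (L := ⟨L.stab, L.mem⟩) (x := x)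
  refine ⟨Members.conj g ⟨L.stab, L.mem⟩, fun x hx => hm.2 (hg x hx),
    orbitHom g fun x hx => hm.1 hx, (isIso_orbitHom_iff _ _).2 fun x hx => hm.2 hx, ?_⟩
  rw [incl_eq, orbitHom_comp _ _ _ _ (by simpa using hg)]
  exact orbitHom_eq _ _ (by simp)

variable (𝓗) in
/-- The orbit category is an EI-category if all endomorphisms are isomorphisms. -/
class IsEI : Prop where
  isIso : ∀ {H : OrbitCat 𝓗} (f : H ⟶ H), IsIso f

/-- Any finite chain in `𝓗` lies below its own last term, whose length bounds it. -/
lemma krullDim_members_le {n : ℕ} (h : ∀ H ∈ 𝓗.carrier, subgroupLength 𝓗 H ≤ n) :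
    Order.krullDim (Members 𝓗) ≤ n := by
  refine iSup_le fun p => ?_
  refine le_trans ?_ (h p.last.1 p.last.2)
  let q : LTSeries {K : Subgroup Γ // K ∈ 𝓗.carrier ∧ K ≤ p.last.1} :=
    LTSeries.mk p.length (fun i => ⟨(p i).1, (p i).2, p.monotone (Fin.le_last i)⟩)
      fun i j hij => p.strictMono hij
  exact le_iSup_of_le q le_rfl

/-- A non-invertible endomorphism gives `g` with `H < g H g⁻¹`; the conjugates by powers of `g` then
form an infinite ascending chain. -/
lemma isEI_of_krullDim_le {n : ℕ} (h : Order.krullDim (Members 𝓗) ≤ n) : IsEI 𝓗 where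
  isIso {H} f := by
    obtain ⟨g, hg, rfl⟩ := exists_orbitHom f
    rw [isIso_orbitHom_iff]
    by_contra! hx
    obtain ⟨x, hx, hx'⟩ := hx
    let K : ℕ → Members 𝓗 := fun i => Members.conj (g ^ i) ⟨H.stab, H.mem⟩
    have hm (i : ℕ) (x : Γ) : x ∈ (K i).1 ↔ (g ^ i)⁻¹ * x * g ^ i ∈ H.stab := Members.mem_conj
    have hK : StrictMono K := by
      refine strictMono_nat_of_lt_succ fun i => lt_of_le_not_ge (fun y hy => ?_) fun h' => hx' ?_
      · have hy : y ∈ (K i).1 := hy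
        change y ∈ (K (i + 1)).1
        rw [hm] at hy ⊢
        simpa [pow_succ, mul_assoc] using hg _ hy
      · have h1 : g ^ i * x * (g ^ i)⁻¹ ∈ (K (i + 1)).1 := by
          rw [hm]
          simpa [pow_succ, mul_assoc] using hx
        have h2 := (hm i _).1 (h' h1)
        simpa [mul_assoc] using h2
    let q : LTSeries (Members 𝓗) := LTSeries.mk (n + 1) (fun i => K i) fun i j hij => hK hij
    have hq : ((n + 1 : ℕ) : WithBot ℕ∞) ≤ n := le_trans (le_iSup_of_le q le_rfl) h
    have : n + 1 ≤ n := by exact_mod_cast hq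
    omega

/-- `f` is a split monomorphism; the endomorphism `g ≫ inv (f ≫ g) ≫ f` is invertible by EI, which
makes `f` a split epimorphism as well. -/
lemma isIso_left_of_isIso_comp [IsEI 𝓗] {H K L : OrbitCat 𝓗} (f : H ⟶ K) (g : K ⟶ L)
    [IsIso (f ≫ g)] : IsIso f := by
  have h1 := IsEI.isIso (g ≫ inv (f ≫ g) ≫ f)
  have : IsSplitEpi f := ⟨⟨⟨inv (g ≫ inv (f ≫ g) ≫ f) ≫ g ≫ inv (f ≫ g), by
    simpa only [Category.assoc] using IsIso.inv_hom_id (g ≫ inv (f ≫ g) ≫ f)⟩⟩⟩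
  have : IsSplitMono f := ⟨⟨⟨g ≫ inv (f ≫ g), by rw [← Category.assoc, IsIso.hom_inv_id]⟩⟩⟩
  exact isIso_of_mono_of_isSplitEpi f

lemma isIso_right_of_isIso_comp [IsEI 𝓗] {H K L : OrbitCat 𝓗} (f : H ⟶ K) (g : K ⟶ L)
    [IsIso (f ≫ g)] : IsIso g := by
  have := isIso_left_of_isIso_comp f g
  exact IsIso.of_isIso_comp_left f g

end Orbit

/-! ### Radicals, tops and a Nakayama lemma -/

section Top

open Opposite

variable {R : Type u} [CommRing R] {Γ : Type u} [Group Γ] {𝓗 : SubgroupFamily Γ}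

/-- The radical of a contramodule `M` at `K`: the span of the images of `M(f)` for the morphisms `f`
with source `K` which are not isomorphisms. -/
def rad (M : Contramodule R 𝓗) (K : OrbitCat 𝓗) : Submodule R (M.obj (op K)) :=
  ⨆ f : Σ L, {f : K ⟶ L // ¬ IsIso f}, LinearMap.range (M.map f.2.1.op).hom

lemma map_mem_rad (M : Contramodule R 𝓗) {K L : OrbitCat 𝓗} (f : K ⟶ L) (hf : ¬ IsIso f)
    (x : M.obj (op L)) : M.map f.op x ∈ rad M K :=
  Submodule.mem_iSup_of_mem (⟨L, f, hf⟩ : Σ L, {f : K ⟶ L // ¬ IsIso f}) ⟨x, rfl⟩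

lemma rad_le_iff {M : Contramodule R 𝓗} {K : OrbitCat 𝓗} {S : Submodule R (M.obj (op K))} :
    rad M K ≤ S ↔ ∀ (L : OrbitCat 𝓗) (f : K ⟶ L), ¬ IsIso f → ∀ x, M.map f.op x ∈ S := by
  refine ⟨fun h L f hf x => h (map_mem_rad M f hf x), fun h => iSup_le ?_⟩
  rintro ⟨L, f, hf⟩ _ ⟨x, rfl⟩
  exact h L f hf x

/-- Each non-isomorphism out of `Γ/K` factors through a proper projection `Γ/K → Γ/L`. The
right-hand side involves only the restriction of `M` to the poset `𝓗`. -/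
lemma rad_toOrbit (M : Contramodule R 𝓗) (K : Members 𝓗) :
    rad M K.toOrbit =
      ⨆ L : {L : Members 𝓗 // K < L}, LinearMap.range (M.map (incl L.2.le).op).hom := by
  apply le_antisymm
  · rw [rad_le_iff]
    intro L f hf x
    obtain ⟨L', h, e, he, rfl⟩ := exists_incl_comp_iso K f
    have hne : K ≠ L' := by
      rintro rfl
      refine hf ?_
      have : incl h = 𝟙 _ := (orbitIncl 𝓗).map_id K
      rw [this]
      infer_instance
    rw [op_comp, Functor.map_comp]
    exact Submodule.mem_iSup_of_mem (⟨L', lt_of_le_of_ne h hne⟩ : {L : Members 𝓗 // K < L})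
      ⟨_, rfl⟩
  · refine iSup_le fun L => ?_
    rintro _ ⟨x, rfl⟩
    exact map_mem_rad M _ (not_isIso_incl L.2) x

lemma app_mem_rad {M N : Contramodule R 𝓗} (η : M ⟶ N) {K : OrbitCat 𝓗} {x : M.obj (op K)}
    (hx : x ∈ rad M K) : η.app (op K) x ∈ rad N K := by
  suffices h : rad M K ≤ (rad N K).comap (η.app (op K)).hom from h hx
  rw [rad_le_iff]
  intro L f hf y
  rw [Submodule.mem_comap]
  change (M.map f.op ≫ η.app (op K)) y ∈ _
  rw [η.naturality]
  exact map_mem_rad N f hf _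

/-- `v` sends the value at `K` into the span of the values at larger `L`, whose coheight is smaller;
by naturality and induction the remaining powers kill those. -/
lemma pow_app_eq_zero {Z : Contramodule R 𝓗} (v : End Z)
    (hv : ∀ (K : OrbitCat 𝓗) (x : Z.obj (op K)), v.app (op K) x ∈ rad Z K) (k : ℕ)
    (K : Members 𝓗) (hK : Order.coheight K < k) (x : Z.obj (op K.toOrbit)) :
    (v ^ k).app (op K.toOrbit) x = 0 := by
  induction k generalizing K with
  | zero => simp at hK
  | succ k ih =>
    have h : (v ^ (k + 1) : End Z) = v ≫ (v ^ k : End Z) := by rw [pow_succ]; rfl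
    rw [h]
    change (v ^ k).app (op K.toOrbit) (v.app (op K.toOrbit) x) = 0
    suffices h : rad Z K.toOrbit ≤ LinearMap.ker ((v ^ k).app (op K.toOrbit)).hom from h (hv _ _)
    rw [rad_toOrbit]
    refine iSup_le fun L => ?_
    rintro _ ⟨y, rfl⟩
    rw [LinearMap.mem_ker]
    change (Z.map (incl L.2.le).op ≫ (v ^ k).app (op K.toOrbit)) y = 0
    rw [NatTrans.naturality]
    change Z.map (incl L.2.le).op ((v ^ k).app _ y) = 0
    rw [ih L.1 ?_ y, map_zero]
    have h1 : Order.coheight L.1 + 1 ≤ Order.coheight K := Order.coheight_add_one_le L.2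
    have h2 : Order.coheight L.1 + 1 < k + 1 := lt_of_le_of_lt h1 (by exact_mod_cast hK)
    exact lt_of_add_lt_add_right h2

variable [IsEI 𝓗]

/-- By EI, precomposition with any `f` keeps a non-isomorphism a non-isomorphism; this is what makes
the radical a subfunctor. -/
lemma rad_map (M : Contramodule R 𝓗) {K' K : OrbitCat 𝓗} (f : K' ⟶ K) {x : M.obj (op K)}
    (hx : x ∈ rad M K) : M.map f.op x ∈ rad M K' := by
  suffices h : rad M K ≤ (rad M K').comap (M.map f.op).hom from h hx
  rw [rad_le_iff]
  intro L g hg y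
  rw [Submodule.mem_comap]
  change (M.map g.op ≫ M.map f.op) y ∈ _
  rw [← Functor.map_comp, ← op_comp]
  exact map_mem_rad M _ (fun h => hg (isIso_right_of_isIso_comp f g)) _

/-- The quotient of a contramodule by its radical. -/
def topObj (M : Contramodule R 𝓗) : Contramodule R 𝓗 where
  obj X := ModuleCat.of R (M.obj X ⧸ rad M X.unop)
  map f := ModuleCat.ofHom (Submodule.mapQ _ _ (M.map f).hom fun _ hx => rad_map M f.unop hx)
  map_id X := by
    ext x
    simp
  map_comp f g := by
    ext x
    simp

variable (R 𝓗) in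
/-- The functor which sends a contramodule to its quotient by the radical. -/
def topFunctor : Contramodule R 𝓗 ⥤ Contramodule R 𝓗 where
  obj M := topObj M
  map {M N} η :=
    { app := fun X => ModuleCat.ofHom (Submodule.mapQ _ _ (η.app X).hom
        fun _ hx => app_mem_rad η (K := X.unop) hx)
      naturality := fun X Y f => by
        ext x
        obtain ⟨x, rfl⟩ := Submodule.mkQ_surjective _ x
        have := congrArg (fun φ => Submodule.Quotient.mk (p := rad N Y.unop) (φ.hom x))
          (η.naturality f)
        exact this }
  map_id M := by
    ext X x
    obtain ⟨x, rfl⟩ := Submodule.mkQ_surjective _ x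
    rfl
  map_comp f g := by
    ext X x
    obtain ⟨x, rfl⟩ := Submodule.mkQ_surjective _ x
    rfl

instance : (topFunctor R 𝓗).Additive where
  map_add {M N f g} := by
    ext X x
    obtain ⟨x, rfl⟩ := Submodule.mkQ_surjective _ x
    rfl

/-- The projection of a contramodule to its quotient by the radical. -/
def topπ (M : Contramodule R 𝓗) : M ⟶ (topFunctor R 𝓗).obj M where
  app _ := ModuleCat.ofHom (Submodule.mkQ _)
  naturality _ _ _ := rfl

lemma topπ_naturality {M N : Contramodule R 𝓗} (η : M ⟶ N) :
    topπ M ≫ (topFunctor R 𝓗).map η = η ≫ topπ N := rfl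

lemma topπ_app_surjective (M : Contramodule R 𝓗) (X : (OrbitCat 𝓗)ᵒᵖ) :
    Function.Surjective ((topπ M).app X) := Submodule.mkQ_surjective _

instance (M : Contramodule R 𝓗) : Epi (topπ M) := by
  rw [NatTrans.epi_iff_epi_app]
  intro X
  rw [ModuleCat.epi_iff_surjective]
  exact topπ_app_surjective M X

lemma topπ_app_eq_zero_iff (M : Contramodule R 𝓗) (K : OrbitCat 𝓗) (x : M.obj (op K)) :
    (topπ M).app (op K) x = 0 ↔ x ∈ rad M K :=
  Submodule.Quotient.mk_eq_zero _

lemma top_map_eq_zero (M : Contramodule R 𝓗) {K L : OrbitCat 𝓗} (f : K ⟶ L) (hf : ¬ IsIso f) :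
    ((topFunctor R 𝓗).obj M).map f.op = 0 := by
  ext x
  obtain ⟨x, rfl⟩ := topπ_app_surjective M _ x
  change (topπ M).app (op K) (M.map f.op x) = 0
  rw [topπ_app_eq_zero_iff]
  exact map_mem_rad M f hf x

/-- An endomorphism which is the identity modulo the radical is an isomorphism. -/
lemma isIso_of_comp_topπ_eq {n : ℕ} (hn : Order.krullDim (Members 𝓗) ≤ n) {Z : Contramodule R 𝓗}
    (w : Z ⟶ Z) (hw : w ≫ topπ Z = topπ Z) : IsIso w := by
  -- The deviation `v` takes values in the radical, so `v ^ (n + 1) = 0` because coheights are at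
  -- most `n`; then `w = 1 - v` is a unit.
  let v : End Z := 𝟙 Z - w
  have hv : (v : Z ⟶ Z) ≫ topπ Z = 0 := by
    change (𝟙 Z - w) ≫ topπ Z = 0
    rw [Preadditive.sub_comp, hw, Category.id_comp, sub_self]
  have hnil : IsNilpotent v := by
    refine ⟨n + 1, ?_⟩
    refine NatTrans.ext (funext fun X => ?_)
    ext x
    refine pow_app_eq_zero v (fun K x => ?_) (n + 1) ⟨X.unop.stab, X.unop.mem⟩ ?_ x
    · rw [← topπ_app_eq_zero_iff]
      exact congrArg (fun φ => φ.app (op K) x) hv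
    · have h := (Order.coheight_le_krullDim (⟨X.unop.stab, X.unop.mem⟩ : Members 𝓗)).trans hn
      have h' : Order.coheight (⟨X.unop.stab, X.unop.mem⟩ : Members 𝓗) ≤ n := by exact_mod_cast h
      exact lt_of_le_of_lt h' (by exact_mod_cast Nat.lt_succ_self n)
  have h1 : IsUnit (1 - v : End Z) := hnil.isUnit_one_sub
  have h2 : (1 - v : End Z) = w := by
    change 𝟙 Z - (𝟙 Z - w) = w
    abel
  rw [h2] at h1
  exact (isUnit_iff_isIso w).1 h1

end Top

/-! ### Values and tops as modules over the Weyl groups -/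

section WeylModules

open Opposite

variable {R : Type u} [CommRing R] {Γ : Type u} [Group Γ] {𝓗 : SubgroupFamily Γ}

lemma inv_mul_mul_mem_of_mem_normalizer {H : Subgroup Γ} {n : Γ}
    (hn : n ∈ Subgroup.normalizer (H : Set Γ)) {x : Γ} (hx : x ∈ H) : n⁻¹ * x * n ∈ H := by
  have := (Subgroup.mem_normalizer_iff.1 (inv_mem hn) x).1 hx
  simpa using this

/-- The automorphism `aK ↦ anK` of `Γ ⧸ K` for `n` in the normalizer of `K`. -/
def normalizerHom (K : OrbitCat 𝓗) (n : Subgroup.normalizer (K.stab : Set Γ)) : K ⟶ K :=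
  orbitHom (n : Γ) fun _ hx => inv_mul_mul_mem_of_mem_normalizer n.2 hx

lemma normalizerHom_mul (K : OrbitCat 𝓗) (m n : Subgroup.normalizer (K.stab : Set Γ)) :
    normalizerHom K (m * n) = normalizerHom K m ≫ normalizerHom K n :=
  (orbitHom_comp _ _ _ _ _).symm

lemma normalizerHom_eq_iff (K : OrbitCat 𝓗) (m n : Subgroup.normalizer (K.stab : Set Γ)) :
    normalizerHom K m = normalizerHom K n ↔ (m : Weyl K.stab) = n := by
  rw [QuotientGroup.eq, Subgroup.mem_subgroupOf]
  refine ⟨fun h => ?_, fun h => orbitHom_eq _ _ h⟩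
  have := congrArg (fun f => toMap f ((1 : Γ) : Γ ⧸ K.stab)) h
  simp only [normalizerHom, toMap_orbitHom] at this
  rw [QuotientGroup.eq] at this
  simpa using this

lemma normalizerHom_one (K : OrbitCat 𝓗) : normalizerHom K 1 = 𝟙 K := orbitHom_one _ _

/-- The action of the normalizer of `K` on the value of a contramodule at `Γ ⧸ K`. -/
def normalizerRep (N : Contramodule R 𝓗) (K : OrbitCat 𝓗) :
    Representation R (Subgroup.normalizer (K.stab : Set Γ)) (N.obj (op K)) where
  toFun n := (N.map (normalizerHom K n).op).hom
  map_one' := by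
    rw [normalizerHom_one, op_id, N.map_id]
    rfl
  map_mul' m n := by
    rw [normalizerHom_mul, op_comp, N.map_comp]
    rfl

/-- The action of the Weyl group of `K` on the value of a contramodule at `Γ ⧸ K`. -/
def weylRep (N : Contramodule R 𝓗) (K : OrbitCat 𝓗) :
    Representation R (Weyl K.stab) (N.obj (op K)) :=
  QuotientGroup.lift _ (normalizerRep N K) fun n hn => by
    have h : normalizerHom K n = normalizerHom K 1 := by
      rw [normalizerHom_eq_iff, QuotientGroup.eq]
      simpa using hn
    change (N.map (normalizerHom K n).op).hom = 1
    rw [h, normalizerHom_one, op_id, N.map_id]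
    rfl

variable (R) in
/-- Evaluation of contramodules at `Γ ⧸ K`, as a functor to modules over the Weyl group. -/
def evalRep (K : OrbitCat 𝓗) : Contramodule R 𝓗 ⥤ Rep.{u} R (Weyl K.stab) where
  obj N := Rep.of (weylRep N K)
  map {M N} η := Rep.ofHom ⟨(η.app (op K)).hom, fun g => by
    induction g using QuotientGroup.induction_on with
    | _ n => exact congrArg ModuleCat.Hom.hom (η.naturality (normalizerHom K n).op)⟩

instance (K : OrbitCat 𝓗) : (evalRep R K).Additive where
  map_add := rfl

/-- The linear map underlying a morphism between values of contramodules. -/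
def evalHom {M N : Contramodule R 𝓗} {K : OrbitCat 𝓗}
    (r : (evalRep R K).obj M ⟶ (evalRep R K).obj N) : M.obj (op K) ⟶ N.obj (op K) :=
  ModuleCat.ofHom r.hom.toLinearMap

lemma evalHom_id (M : Contramodule R 𝓗) (K : OrbitCat 𝓗) :
    evalHom (𝟙 ((evalRep R K).obj M)) = 𝟙 (M.obj (op K)) := rfl

lemma evalHom_map_comp {L M N : Contramodule R 𝓗} {K : OrbitCat 𝓗} (η : L ⟶ M)
    (r : (evalRep R K).obj M ⟶ (evalRep R K).obj N) :
    evalHom ((evalRep R K).map η ≫ r) = η.app (op K) ≫ evalHom r := rfl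

/-- A representative of the isomorphism class of an object. -/
def isoRep (K : OrbitCat 𝓗) : OrbitCat 𝓗 := Quotient.out (toSkeleton K)

/-- The isomorphism with the representative. -/
def isoRepIso (K : OrbitCat 𝓗) : K ≅ isoRep K :=
  (Quotient.mk_eq_iff_out.1 (rfl : (⟦K⟧ : Skeleton (OrbitCat 𝓗)) = ⟦K⟧)).some

lemma isoRep_eq {H K : OrbitCat 𝓗} (e : H ≅ K) : isoRep H = isoRep K :=
  congrArg Quotient.out (Quotient.sound ⟨e⟩ : toSkeleton H = toSkeleton K)

variable [IsEI 𝓗]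

lemma exists_normalizerHom (K : OrbitCat 𝓗) (f : K ⟶ K) :
    ∃ n : Subgroup.normalizer (K.stab : Set Γ), f = normalizerHom K n := by
  obtain ⟨g, hg, rfl⟩ := exists_orbitHom f
  have h := (isIso_orbitHom_iff g hg).1 (IsEI.isIso _)
  refine ⟨⟨g, ?_⟩, rfl⟩
  rw [← inv_mem_iff, Subgroup.mem_normalizer_iff]
  intro x
  rw [inv_inv]
  exact ⟨fun hx => hg x hx, fun hx => h x hx⟩

lemma map_comp_evalHom {N N' : Contramodule R 𝓗} {K : OrbitCat 𝓗}
    (r : (evalRep R K).obj N ⟶ (evalRep R K).obj N') (f : K ⟶ K) :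
    N.map f.op ≫ evalHom r = evalHom r ≫ N'.map f.op := by
  obtain ⟨n, rfl⟩ := exists_normalizerHom K f
  ext x
  exact Rep.hom_comm_apply r (n : Weyl K.stab) x

variable (R) in
/-- The functor which sends a contramodule `M` to the `WK`-module `M(Γ ⧸ K) / rad`. -/
def topRep (K : OrbitCat 𝓗) : Contramodule R 𝓗 ⥤ Rep.{u} R (Weyl K.stab) :=
  topFunctor R 𝓗 ⋙ evalRep R K

instance (K : OrbitCat 𝓗) : (topRep R K).Additive := by
  unfold topRep
  infer_instance

section Transport

variable {M N : Contramodule R 𝓗}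
  (r : ∀ K : OrbitCat 𝓗, (evalRep R K).obj M ⟶ (evalRep R K).obj N)

/-- The transport of the value of `r` at an isomorphic object. -/
def transportApp {K X : OrbitCat 𝓗} (β : K ≅ X) : M.obj (op K) ⟶ N.obj (op K) :=
  M.map β.inv.op ≫ evalHom (r X) ≫ N.map β.hom.op

/-- Two isomorphisms differ by an automorphism of `X`, which comes from the normalizer and so
commutes with the equivariant map `r X`. -/
lemma transportApp_eq {K X Y : OrbitCat 𝓗} (h : X = Y) (β : K ≅ X) (γ : K ≅ Y) :
    transportApp r β = transportApp r γ := by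
  subst h
  have h1 : γ.inv = (γ.inv ≫ β.hom) ≫ β.inv := by simp
  rw [transportApp, transportApp, h1, op_comp, M.map_comp, Category.assoc,
    reassoc_of% (map_comp_evalHom (r X) (γ.inv ≫ β.hom)), ← N.map_comp, ← op_comp]
  simp

/-- A family of maps of modules over the Weyl groups extends, from representatives of the
isomorphism classes, to a morphism of contramodules if the morphisms which are not isomorphisms
act by zero. -/
def transportHom (hM : ∀ {K L : OrbitCat 𝓗} (f : K ⟶ L), ¬ IsIso f → M.map f.op = 0)
    (hN : ∀ {K L : OrbitCat 𝓗} (f : K ⟶ L), ¬ IsIso f → N.map f.op = 0) : M ⟶ N where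
  app X := transportApp r (isoRepIso X.unop)
  naturality X Y f := by
    by_cases hf : IsIso f.unop
    · rw [transportApp_eq r (isoRep_eq (asIso f.unop)) (isoRepIso Y.unop)
        (asIso f.unop ≪≫ isoRepIso X.unop), transportApp, transportApp]
      have h : f ≫ (inv f.unop).op = 𝟙 X := Quiver.Hom.unop_inj (IsIso.inv_hom_id f.unop)
      simp only [Iso.trans_inv, op_comp, Functor.map_comp, asIso_inv, Category.assoc,
        Iso.trans_hom, asIso_hom]
      rw [← M.map_comp_assoc f, h, M.map_id, Category.id_comp]
      rfl
    · rw [show M.map f = 0 from hM f.unop hf, show N.map f = 0 from hN f.unop hf]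
      simp

end Transport

/-- A morphism to a projective contramodule which is a split monomorphism modulo radicals, as a
morphism of modules over the Weyl groups, is a split monomorphism. -/
theorem isSplitMono_of_topRep {n : ℕ} (hn : Order.krullDim (Members 𝓗) ≤ n)
    {Z P : Contramodule R 𝓗} [Projective P] (i : Z ⟶ P)
    (h : ∀ K, IsSplitMono ((topRep R K).map i)) : IsSplitMono i := by
  let r (K : OrbitCat 𝓗) : (evalRep R K).obj ((topFunctor R 𝓗).obj P) ⟶
    (evalRep R K).obj ((topFunctor R 𝓗).obj Z) := (h K).exists_splitMono.some.retraction
  have hr (K : OrbitCat 𝓗) :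
      ((topFunctor R 𝓗).map i).app (op K) ≫ evalHom (r K) = 𝟙 _ := by
    rw [← evalHom_map_comp, ← evalHom_id]
    exact congrArg evalHom (h K).exists_splitMono.some.id
  let ρ' : (topFunctor R 𝓗).obj P ⟶ (topFunctor R 𝓗).obj Z :=
    transportHom r (top_map_eq_zero P) (top_map_eq_zero Z)
  have hρ' : (topFunctor R 𝓗).map i ≫ ρ' = 𝟙 _ := by
    refine NatTrans.ext (funext fun X => ?_)
    change ((topFunctor R 𝓗).map i).app X ≫ transportApp r (isoRepIso X.unop) = 𝟙 _
    rw [transportApp]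
    have := ((topFunctor R 𝓗).map i).naturality (isoRepIso X.unop).inv.op
    rw [← Category.assoc]
    erw [← this]
    rw [Category.assoc, reassoc_of% (hr (isoRep X.unop)), ← Functor.map_comp, ← op_comp,
      Iso.hom_inv_id, op_id]
    exact CategoryTheory.Functor.map_id _ X
  -- Projectivity of `P` lifts the retraction `ρ'` of the tops; `i ≫ ρ` is then the identity modulo
  -- the radical, hence invertible.
  let ρ : P ⟶ Z := Projective.factorThru (topπ P ≫ ρ') (topπ Z)
  have hρ : (i ≫ ρ) ≫ topπ Z = topπ Z := by
    rw [Category.assoc, Projective.factorThru_comp, ← Category.assoc, ← topπ_naturality,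
      Category.assoc, hρ', Category.comp_id]
  have := isIso_of_comp_topπ_eq hn (i ≫ ρ) hρ
  exact ⟨⟨⟨ρ ≫ inv (i ≫ ρ), by rw [← Category.assoc, IsIso.hom_inv_id]⟩⟩⟩

/-! ### Coinduction, the right adjoint of the top -/

section Coinduction

variable (K : OrbitCat 𝓗)

/-- The automorphism `aK ↦ anK` of `Γ ⧸ K` for `n` in the normalizer of `K`, as an isomorphism. -/
def normalizerIso (n : Subgroup.normalizer (K.stab : Set Γ)) : K ≅ K :=
  haveI := IsEI.isIso (normalizerHom K n)
  asIso (normalizerHom K n)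

lemma normalizerIso_hom (n : Subgroup.normalizer (K.stab : Set Γ)) :
    (normalizerIso K n).hom = normalizerHom K n := rfl

lemma exists_normalizerIso_trans {H : OrbitCat 𝓗} (β γ : K ≅ H) :
    ∃ n : Subgroup.normalizer (K.stab : Set Γ), β = normalizerIso K n ≪≫ γ := by
  obtain ⟨n, hn⟩ := exists_normalizerHom K (β.hom ≫ γ.inv)
  refine ⟨n, Iso.ext ?_⟩
  rw [Iso.trans_hom, normalizerIso_hom, ← hn]
  simp

variable (V : Rep.{u} R (Weyl K.stab))

/-- The equivariant functions from the isomorphisms `K ≅ H` to `V`. -/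
def coindSubmodule (H : OrbitCat 𝓗) : Submodule R ((K ≅ H) → V) where
  carrier := {φ | ∀ (n : Subgroup.normalizer (K.stab : Set Γ)) (β : K ≅ H),
    φ (normalizerIso K n ≪≫ β) = V.ρ (n : Weyl K.stab) (φ β)}
  add_mem' hφ hψ n β := by simp [hφ n β, hψ n β]
  zero_mem' n β := by simp
  smul_mem' c φ hφ n β := by simp [hφ n β]

open Classical in
/-- Restriction of equivariant functions along isomorphisms, and zero for other morphisms. -/
def coindMap {H H' : OrbitCat 𝓗} (f : H' ⟶ H) :
    coindSubmodule K V H →ₗ[R] coindSubmodule K V H' where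
  toFun φ := ⟨fun β => if h : IsIso f then φ.1 (β ≪≫ asIso f) else 0, fun n β => by
    by_cases h : IsIso f
    · simp only [h, dif_pos]
      exact φ.2 n (β ≪≫ asIso f)
    · simp [h]⟩
  map_add' φ ψ := by
    ext β
    by_cases h : IsIso f <;> simp [h]
  map_smul' c φ := by
    ext β
    by_cases h : IsIso f <;> simp [h]

lemma coindMap_of_isIso {H H' : OrbitCat 𝓗} (f : H' ⟶ H) [IsIso f] (φ : coindSubmodule K V H)
    (β : K ≅ H') : (coindMap K V f φ).1 β = φ.1 (β ≪≫ asIso f) := by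
  classical
  exact dif_pos ‹_›

lemma coindMap_of_not_isIso {H H' : OrbitCat 𝓗} (f : H' ⟶ H) (hf : ¬ IsIso f)
    (φ : coindSubmodule K V H) : coindMap K V f φ = 0 := by
  classical
  exact Subtype.ext (funext fun β => dif_neg hf)

/-- The contramodule coinduced from a module `V` over the Weyl group of `K`, on which the morphisms
which are not isomorphisms act by zero. -/
def coindContramodule : Contramodule R 𝓗 where
  obj X := ModuleCat.of R (coindSubmodule K V X.unop)
  map f := ModuleCat.ofHom (coindMap K V f.unop)
  map_id X := by
    refine ModuleCat.hom_ext (LinearMap.ext fun φ => Subtype.ext (funext fun β => ?_))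
    refine (coindMap_of_isIso K V (𝟙 X.unop) φ β).trans ?_
    have h : β ≪≫ asIso (𝟙 X.unop) = β := Iso.ext (by simp)
    rw [h]
    rfl
  map_comp {X Y Z} f g := by
    refine ModuleCat.hom_ext (LinearMap.ext fun φ => ?_)
    change coindMap K V (g.unop ≫ f.unop) φ = coindMap K V g.unop (coindMap K V f.unop φ)
    by_cases hf : IsIso f.unop
    · by_cases hg : IsIso g.unop
      · refine Subtype.ext (funext fun β => ?_)
        rw [coindMap_of_isIso, coindMap_of_isIso, coindMap_of_isIso]
        exact congrArg φ.1 (Iso.ext (by simp))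
      · rw [coindMap_of_not_isIso K V g.unop hg, coindMap_of_not_isIso]
        exact fun h => hg (isIso_left_of_isIso_comp g.unop f.unop)
    · rw [coindMap_of_not_isIso K V f.unop hf, coindMap_of_not_isIso, map_zero]
      exact fun h => hf (isIso_right_of_isIso_comp g.unop f.unop)

variable {V}

/-- Composition of equivariant functions with a morphism of modules. -/
def coindComp {W : Rep.{u} R (Weyl K.stab)} (e : V ⟶ W) (H : OrbitCat 𝓗) :
    coindSubmodule K V H →ₗ[R] coindSubmodule K W H where
  toFun φ := ⟨fun β => e.hom (φ.1 β), fun n β =>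
    (congrArg e.hom (φ.2 n β)).trans (Rep.hom_comm_apply e _ _)⟩
  map_add' _ _ := Subtype.ext (funext fun _ => map_add e.hom _ _)
  map_smul' _ _ := Subtype.ext (funext fun _ => map_smul e.hom _ _)

/-- The morphism of coinduced contramodules induced by a morphism of modules. -/
def coindContramoduleMap {W : Rep.{u} R (Weyl K.stab)} (e : V ⟶ W) :
    coindContramodule K V ⟶ coindContramodule K W where
  app X := ModuleCat.ofHom (coindComp K e X.unop)
  naturality X Y f := by
    refine ModuleCat.hom_ext (LinearMap.ext fun (φ : coindSubmodule K V X.unop) => ?_)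
    change coindComp K e _ (coindMap K V f.unop φ) = coindMap K W f.unop (coindComp K e _ φ)
    by_cases hf : IsIso f.unop
    · refine Subtype.ext (funext fun β => ?_)
      rw [coindMap_of_isIso]
      exact congrArg e.hom (coindMap_of_isIso K V f.unop φ β)
    · rw [coindMap_of_not_isIso K V _ hf, coindMap_of_not_isIso K W _ hf, map_zero]

/-- The Weyl group acts simply transitively on the isomorphisms `K ≅ H`, so an equivariant function
is freely determined by its value at one `γ`; it suffices to lift that value. -/
instance {W : Rep.{u} R (Weyl K.stab)} (e : V ⟶ W) [Epi e] : Epi (coindContramoduleMap K e) := by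
  rw [NatTrans.epi_iff_epi_app]
  intro X
  rw [ModuleCat.epi_iff_surjective]
  intro (ψ : coindSubmodule K W X.unop)
  have he := (Rep.epi_iff_surjective e).1 inferInstance
  by_cases hX : Nonempty (K ≅ X.unop)
  · obtain ⟨γ⟩ := hX
    obtain ⟨v, hv⟩ := he (ψ.1 γ)
    choose n hn using fun β => exists_normalizerIso_trans K β γ
    refine ⟨⟨fun β => V.ρ (n β : Weyl K.stab) v, fun m β => ?_⟩, Subtype.ext (funext fun β => ?_)⟩
    · change V.ρ (n (normalizerIso K m ≪≫ β) : Weyl K.stab) v =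
        V.ρ (m : Weyl K.stab) (V.ρ (n β : Weyl K.stab) v)
      rw [← Module.End.mul_apply, ← map_mul, ← QuotientGroup.mk_mul]
      congr 2
      rw [← normalizerHom_eq_iff]
      have h := hn (normalizerIso K m ≪≫ β)
      have h' := (congrArg (fun δ => normalizerIso K m ≪≫ δ) (hn β)).symm.trans h
      have h'' := congrArg (fun δ => (δ ≪≫ γ.symm).hom) h'
      simp only [Iso.trans_hom, Category.assoc, Iso.symm_hom, Iso.hom_inv_id, Category.comp_id,
        normalizerIso_hom] at h''
      rw [normalizerHom_mul, h'']
    · change e.hom (V.ρ (n β : Weyl K.stab) v) = ψ.1 β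
      rw [Rep.hom_comm_apply, hv]
      conv_rhs => rw [hn β, ψ.2]
  · refine ⟨0, Subtype.ext (funext fun β => absurd ⟨β⟩ hX)⟩

variable {K}

/-- The linear map to equivariant functions which corresponds to an equivariant linear map. -/
def toCoindApp {P : Contramodule R 𝓗} (t : P.obj (op K) →ₗ[R] V)
    (hn : ∀ (n : Subgroup.normalizer (K.stab : Set Γ)) (x : P.obj (op K)),
      t (P.map (normalizerHom K n).op x) = V.ρ (n : Weyl K.stab) (t x)) (H : OrbitCat 𝓗) :
    P.obj (op H) →ₗ[R] coindSubmodule K V H where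
  toFun x := ⟨fun β => t (P.map β.hom.op x), fun n β => by
    change t (P.map (β.hom.op ≫ (normalizerHom K n).op) x) = _
    rw [P.map_comp]
    exact hn n (P.map β.hom.op x)⟩
  map_add' x y := by
    refine Subtype.ext (funext fun β => ?_)
    change t (P.map β.hom.op (x + y)) = t (P.map β.hom.op x) + t (P.map β.hom.op y)
    rw [map_add, map_add]
  map_smul' c x := by
    refine Subtype.ext (funext fun β => ?_)
    change t (P.map β.hom.op (c • x)) = c • t (P.map β.hom.op x)
    rw [map_smul, map_smul]

/-- The morphism to a coinduced contramodule which corresponds to an equivariant linear map. -/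
def toCoind {P : Contramodule R 𝓗} (t : P.obj (op K) →ₗ[R] V) (ht : rad P K ≤ LinearMap.ker t)
    (hn : ∀ (n : Subgroup.normalizer (K.stab : Set Γ)) (x : P.obj (op K)),
      t (P.map (normalizerHom K n).op x) = V.ρ (n : Weyl K.stab) (t x)) :
    P ⟶ coindContramodule K V where
  app X := ModuleCat.ofHom (toCoindApp t hn X.unop)
  naturality X Y f := by
    refine ModuleCat.hom_ext (LinearMap.ext fun x => Subtype.ext (funext fun β => ?_))
    change t ((P.map f ≫ P.map β.hom.op) x) =
      (coindMap K V f.unop (toCoindApp t hn X.unop x)).1 β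
    rw [← P.map_comp]
    by_cases hf : IsIso f.unop
    · rw [coindMap_of_isIso]
      rfl
    · rw [coindMap_of_not_isIso K V _ hf]
      exact ht (map_mem_rad P (β.hom ≫ f.unop)
        (fun h => hf (isIso_right_of_isIso_comp β.hom f.unop)) x)

/-- The linear map which corresponds to a morphism to a coinduced contramodule. -/
def ofCoind {P : Contramodule R 𝓗} (σ : P ⟶ coindContramodule K V) : P.obj (op K) →ₗ[R] V :=
  LinearMap.proj (Iso.refl K) ∘ₗ (coindSubmodule K V K).subtype ∘ₗ (σ.app (op K)).hom

lemma ofCoind_map {P : Contramodule R 𝓗} (σ : P ⟶ coindContramodule K V) {L : OrbitCat 𝓗}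
    (f : K ⟶ L) (x : P.obj (op L)) :
    ofCoind σ (P.map f.op x) =
      (coindMap K V f ((σ.app (op L)).hom x : coindSubmodule K V L)).1 (Iso.refl K) := by
  change ((P.map f.op ≫ σ.app (op K)).hom x : coindSubmodule K V K).1 (Iso.refl K) = _
  rw [σ.naturality]
  rfl

lemma rad_le_ker_ofCoind {P : Contramodule R 𝓗} (σ : P ⟶ coindContramodule K V) :
    rad P K ≤ LinearMap.ker (ofCoind σ) := by
  rw [rad_le_iff]
  intro L f hf x
  exact (ofCoind_map σ f x).trans (congrArg (fun ψ : coindSubmodule K V K => ψ.1 (Iso.refl K))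
    (coindMap_of_not_isIso K V f hf _))

lemma ofCoind_normalizerHom {P : Contramodule R 𝓗} (σ : P ⟶ coindContramodule K V)
    (n : Subgroup.normalizer (K.stab : Set Γ)) (x : P.obj (op K)) :
    ofCoind σ (P.map (normalizerHom K n).op x) = V.ρ (n : Weyl K.stab) (ofCoind σ x) := by
  have := IsEI.isIso (normalizerHom K n)
  refine (ofCoind_map σ _ x).trans ((coindMap_of_isIso K V (normalizerHom K n) _ _).trans ?_)
  refine Eq.trans ?_ (((σ.app (op K)).hom x : coindSubmodule K V K).2 n (Iso.refl K))
  congr 1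

variable (K) in
/-- A projective contramodule has projective `WK`-modules of values modulo radicals. -/
theorem projective_topRep_obj (P : Contramodule R 𝓗) [Projective P] :
    Projective ((topRep R K).obj P) where
  factors {V W} t e _ := by
    -- By adjunction, the lifting problem for the top of `P` becomes one for `P` itself along an
    -- epimorphism of coinduced contramodules.
    let t' : P.obj (op K) →ₗ[R] W := t.hom.toLinearMap ∘ₗ (rad P K).mkQ
    let τ : P ⟶ coindContramodule K W := toCoind t'
      (fun x hx => by
        exact (congrArg t.hom ((Submodule.Quotient.mk_eq_zero _).2 hx)).trans (map_zero t.hom))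
      (fun n x => Rep.hom_comm_apply t (n : Weyl K.stab) ((rad P K).mkQ x))
    let σ : P ⟶ coindContramodule K V := Projective.factorThru τ (coindContramoduleMap K e)
    have hσ : σ ≫ coindContramoduleMap K e = τ := Projective.factorThru_comp _ _
    refine ⟨Rep.ofHom ⟨Submodule.liftQ _ (ofCoind σ) (rad_le_ker_ofCoind σ), fun g => ?_⟩, ?_⟩
    · induction g using QuotientGroup.induction_on with
      | _ n =>
        refine LinearMap.ext fun x => ?_
        obtain ⟨x, rfl⟩ := Submodule.mkQ_surjective _ x
        exact ofCoind_normalizerHom σ n x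
    · refine Rep.hom_ext (Representation.IntertwiningMap.ext (LinearMap.ext fun x => ?_))
      obtain ⟨x, rfl⟩ := Submodule.mkQ_surjective _ x
      have h := congrArg (fun φ => ofCoind φ x) hσ
      refine h.trans ?_
      change t' (P.map (𝟙 (op K)) x) = _
      rw [P.map_id]
      rfl

end Coinduction

end WeylModules

/-! ### Free presheaves of modules and enough projectives -/

section Free

open Opposite

/-- A presheaf of sets on a small category. -/
structure SetPresheaf (𝒞 : Type u) [Category.{u} 𝒞] where
  obj : 𝒞 → Type u
  map : ∀ {X Y : 𝒞}, (X ⟶ Y) → obj Y → obj X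
  map_id : ∀ (X : 𝒞) (z : obj X), map (𝟙 X) z = z
  map_comp : ∀ {X Y Z : 𝒞} (f : X ⟶ Y) (g : Y ⟶ Z) (z : obj Z), map (f ≫ g) z = map f (map g z)

variable (R : Type u) [CommRing R] {𝒞 : Type u} [Category.{u} 𝒞] {𝒟 : Type u} [Category.{u} 𝒟]

/-- The free presheaf of `R`-modules on a presheaf of sets. -/
def SetPresheaf.lin (S : SetPresheaf 𝒞) : 𝒞ᵒᵖ ⥤ ModuleCat.{u} R where
  obj X := ModuleCat.of R (S.obj X.unop →₀ R)
  map f := ModuleCat.ofHom (Finsupp.lmapDomain R R (S.map f.unop))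
  map_id X := by
    refine ModuleCat.hom_ext (Finsupp.lhom_ext fun z c => ?_)
    change Finsupp.mapDomain _ _ = _
    rw [Finsupp.mapDomain_single]
    exact congrArg (fun w => Finsupp.single w c) (S.map_id _ z)
  map_comp f g := by
    refine ModuleCat.hom_ext (Finsupp.lhom_ext fun z c => ?_)
    change Finsupp.mapDomain _ _ = Finsupp.mapDomain _ (Finsupp.mapDomain _ _)
    rw [Finsupp.mapDomain_single, Finsupp.mapDomain_single, Finsupp.mapDomain_single]
    exact congrArg (fun w => Finsupp.single w c) (S.map_comp _ _ z)

lemma SetPresheaf.lin_map_single (S : SetPresheaf 𝒞) {X Y : 𝒞} (f : X ⟶ Y) (z : S.obj Y) (c : R) :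
    (S.lin R).map f.op (Finsupp.single z c : S.obj Y →₀ R) =
      (Finsupp.single (S.map f z) c : S.obj X →₀ R) :=
  Finsupp.mapDomain_single

/-- The restriction of a presheaf along a functor. -/
def SetPresheaf.restrict (F : 𝒟 ⥤ 𝒞) (S : SetPresheaf 𝒞) : SetPresheaf 𝒟 where
  obj X := S.obj (F.obj X)
  map f := S.map (F.map f)
  map_id X z := by rw [F.map_id, S.map_id]
  map_comp f g z := by rw [F.map_comp, S.map_comp]

/-- A presheaf is a coproduct of representables if it has a family of elements of which every
element is a restriction in a unique way. -/
def SetPresheaf.IsCoprodRepr (S : SetPresheaf 𝒞) : Prop :=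
  ∃ (ι : Type u) (c : ι → 𝒞) (y : ∀ i, S.obj (c i)),
    ∀ X, Function.Bijective fun p : Σ i, X ⟶ c i => S.map p.2 (y p.1)

variable {R}

/-- The morphism from a free presheaf given by compatible values on the elements. -/
def SetPresheaf.linDesc (S : SetPresheaf 𝒞) {A : 𝒞ᵒᵖ ⥤ ModuleCat.{u} R}
    (a : ∀ X : 𝒞, S.obj X → A.obj (op X))
    (ha : ∀ {X Y : 𝒞} (f : X ⟶ Y) (z : S.obj Y), a X (S.map f z) = A.map f.op (a Y z)) :
    S.lin R ⟶ A where
  app X := ModuleCat.ofHom (Finsupp.lift (A.obj X) R (S.obj X.unop) (a X.unop))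
  naturality X Y f := by
    refine ModuleCat.hom_ext (Finsupp.lhom_ext fun z c => ?_)
    change Finsupp.lift _ _ _ _ (Finsupp.mapDomain _ _) = A.map f (Finsupp.lift _ _ _ _ _)
    rw [Finsupp.mapDomain_single, Finsupp.lift_apply, Finsupp.lift_apply, Finsupp.sum_single_index,
      Finsupp.sum_single_index, map_smul]
    · exact congrArg (c • ·) (ha f.unop z)
    · simp
    · simp

lemma SetPresheaf.linDesc_single (S : SetPresheaf 𝒞) {A : 𝒞ᵒᵖ ⥤ ModuleCat.{u} R}
    (a : ∀ X : 𝒞, S.obj X → A.obj (op X))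
    (ha : ∀ {X Y : 𝒞} (f : X ⟶ Y) (z : S.obj Y), a X (S.map f z) = A.map f.op (a Y z))
    {X : 𝒞} (z : S.obj X) :
    (S.linDesc a ha).app (op X) (Finsupp.single z 1 : S.obj X →₀ R) = a X z := by
  change Finsupp.lift _ _ _ _ _ = _
  rw [Finsupp.lift_apply, Finsupp.sum_single_index] <;> simp

lemma SetPresheaf.lin_hom_ext (S : SetPresheaf 𝒞) {A : 𝒞ᵒᵖ ⥤ ModuleCat.{u} R}
    {f g : S.lin R ⟶ A} (h : ∀ (X : 𝒞) (z : S.obj X),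
      f.app (op X) (Finsupp.single z 1 : S.obj X →₀ R) =
        g.app (op X) (Finsupp.single z 1 : S.obj X →₀ R)) : f = g := by
  refine NatTrans.ext (funext fun X => ModuleCat.hom_ext (Finsupp.lhom_ext' fun z => ?_))
  exact LinearMap.ext_ring (h X.unop z)

/-- The free presheaf of modules on a coproduct of representables is projective. -/
lemma SetPresheaf.IsCoprodRepr.projective {S : SetPresheaf 𝒞} (hS : S.IsCoprodRepr) :
    Projective (S.lin R) where
  factors {A B} f e _ := by
    obtain ⟨ι, c, y, hb⟩ := hS
    have he (X) : Function.Surjective (e.app X) :=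
      (ModuleCat.epi_iff_surjective _).1 inferInstance
    -- By Yoneda a map out of the coproduct is a free choice of values on the generators `y i`, so
    -- it suffices to lift these.
    choose a ha using fun i => he _ (f.app (op (c i)) (Finsupp.single (y i) 1 : S.obj (c i) →₀ R))
    let q (X : 𝒞) := Equiv.ofBijective _ (hb X)
    have hq {X Y : 𝒞} (g : X ⟶ Y) (z : S.obj Y) :
        (q X).symm (S.map g z) = ⟨((q Y).symm z).1, g ≫ ((q Y).symm z).2⟩ := by
      rw [Equiv.symm_apply_eq]
      change _ = S.map (g ≫ ((q Y).symm z).2) (y _)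
      rw [S.map_comp]
      exact congrArg (S.map g) ((q Y).apply_symm_apply z).symm
    refine ⟨S.linDesc (fun X z => A.map ((q X).symm z).2.op (a ((q X).symm z).1)) ?_, ?_⟩
    · intro X Y g z
      rw [hq, op_comp, A.map_comp]
      rfl
    · refine S.lin_hom_ext fun X z => ?_
      change e.app (op X) (SetPresheaf.linDesc _ _ _ |>.app (op X) _) = _
      rw [S.linDesc_single]
      obtain ⟨⟨i, g⟩, rfl⟩ := (q X).surjective z
      rw [Equiv.symm_apply_apply]
      change (A.map g.op ≫ e.app (op X)) (a i) = _
      rw [e.naturality]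
      change B.map g.op (e.app _ (a i)) = _
      rw [ha]
      change (f.app _ ≫ B.map g.op) _ = f.app _ (Finsupp.single (S.map g (y i)) 1 : S.obj X →₀ R)
      rw [← f.naturality, ← S.lin_map_single R]
      rfl

/-- The coproduct of the representables indexed by all elements of a presheaf of modules. -/
def coverPresheaf (M : 𝒞ᵒᵖ ⥤ ModuleCat.{u} R) : SetPresheaf 𝒞 where
  obj X := Σ p : Σ J : 𝒞, M.obj (op J), X ⟶ p.1
  map f z := ⟨z.1, f ≫ z.2⟩
  map_id X z := by simp
  map_comp f g z := by simp

lemma coverPresheaf_compat (M : 𝒞ᵒᵖ ⥤ ModuleCat.{u} R) {X Y : 𝒞} (f : X ⟶ Y)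
    (z : (coverPresheaf M).obj Y) :
    M.map ((coverPresheaf M).map f z).2.op ((coverPresheaf M).map f z).1.2 =
      M.map f.op (M.map z.2.op z.1.2) := by
  change M.map (z.2.op ≫ f.op) z.1.2 = _
  rw [M.map_comp]
  rfl

/-- The free presheaf of modules on all elements of a presheaf of modules covers it. -/
def coverHom (M : 𝒞ᵒᵖ ⥤ ModuleCat.{u} R) : (coverPresheaf M).lin R ⟶ M :=
  (coverPresheaf M).linDesc (fun _ z => M.map z.2.op z.1.2) fun f z => coverPresheaf_compat M f z

instance (M : 𝒞ᵒᵖ ⥤ ModuleCat.{u} R) : Epi (coverHom M) := by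
  rw [NatTrans.epi_iff_epi_app]
  intro X
  rw [ModuleCat.epi_iff_surjective]
  intro x
  refine ⟨(Finsupp.single ⟨⟨X.unop, x⟩, 𝟙 X.unop⟩ 1 : (coverPresheaf M).obj X.unop →₀ R), ?_⟩
  refine ((coverPresheaf M).linDesc_single (fun _ z => M.map z.2.op z.1.2)
    (fun f z => coverPresheaf_compat M f z) _).trans ?_
  change M.map (𝟙 X) x = x
  rw [M.map_id]
  rfl

lemma isCoprodRepr_coverPresheaf (M : 𝒞ᵒᵖ ⥤ ModuleCat.{u} R) : (coverPresheaf M).IsCoprodRepr := by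
  refine ⟨Σ J : 𝒞, M.obj (op J), fun p => p.1, fun p => ⟨p, 𝟙 _⟩, fun X => ⟨?_, ?_⟩⟩
  · rintro ⟨p, f⟩ ⟨p', f'⟩ h
    simpa [coverPresheaf] using h
  · rintro ⟨p, f⟩
    exact ⟨⟨p, f⟩, by simp [coverPresheaf]⟩

instance enoughProjectives_presheaf : EnoughProjectives (𝒞ᵒᵖ ⥤ ModuleCat.{u} R) where
  presentation M := ⟨
    { p := (coverPresheaf M).lin R
      f := coverHom M
      projective := (isCoprodRepr_coverPresheaf M).projective }⟩

end Free

/-! ### Restriction to the poset of subgroups preserves projectives -/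

section Restriction

open Opposite

variable {R : Type u} [CommRing R] {Γ : Type u} [Group Γ] {𝓗 : SubgroupFamily Γ}

variable (R 𝓗) in
/-- Restriction of contramodules to the poset of the subgroups in the class. -/
def restrictFunctor : Contramodule R 𝓗 ⥤ ((Members 𝓗)ᵒᵖ ⥤ ModuleCat.{u} R) :=
  (Functor.whiskeringLeft _ _ _).obj (orbitIncl 𝓗).op

instance : (restrictFunctor R 𝓗).Additive where
  map_add := rfl

/-- The factorization of a morphism as a projection followed by an isomorphism is unique. -/
lemma incl_comp_iso_unique {K L L' : Members 𝓗} {J : OrbitCat 𝓗} (h : K ≤ L) (h' : K ≤ L')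
    (e : {e : L.toOrbit ⟶ J // IsIso e}) (e' : {e : L'.toOrbit ⟶ J // IsIso e})
    (he : incl h ≫ e.1 = incl h' ≫ e'.1) :
    (⟨L, e⟩ : Σ L : Members 𝓗, {e : L.toOrbit ⟶ J // IsIso e}) = ⟨L', e'⟩ := by
  obtain ⟨e, hi⟩ := e
  obtain ⟨e', hi'⟩ := e'
  obtain ⟨g, hg, rfl⟩ := exists_orbitHom e
  obtain ⟨g', hg', rfl⟩ := exists_orbitHom e'
  have h1 := congrArg (fun φ => toMap φ ((1 : Γ) : Γ ⧸ K.1)) he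
  change ((1 * 1 * g : Γ) : Γ ⧸ J.stab) = ((1 * 1 * g' : Γ) : Γ ⧸ J.stab) at h1
  rw [QuotientGroup.eq] at h1
  have h2 : g⁻¹ * g' ∈ J.stab := by simpa using h1
  have hj := hi
  have hj' := hi'
  rw [isIso_orbitHom_iff] at hj hj'
  have hL : L = L' := by
    refine Subtype.ext (Subgroup.ext fun x => ⟨fun hx => hj' x ?_, fun hx => hj x ?_⟩)
    · simpa [mul_assoc] using mul_mem (mul_mem (inv_mem h2) (hg x hx)) h2
    · simpa [mul_assoc] using mul_mem (mul_mem h2 (hg' x hx)) (inv_mem h2)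
  subst hL
  rw [Sigma.mk.inj_iff]
  exact ⟨rfl, heq_of_eq (Subtype.ext (orbitHom_eq hg hg' h2))⟩

/-- A morphism `Γ/K → Γ/J` factors uniquely as a projection to some `Γ/L` and an isomorphism `e`. So
the restriction of the representable of `J` is the coproduct, over the pairs `(L, e)`, of the
representables of `L` on the poset. -/
lemma isCoprodRepr_restrict_coverPresheaf (M : Contramodule R 𝓗) :
    ((coverPresheaf M).restrict (orbitIncl 𝓗)).IsCoprodRepr := by
  refine ⟨Σ (p : Σ J : OrbitCat 𝓗, M.obj (op J)) (L : Members 𝓗), {e : L.toOrbit ⟶ p.1 // IsIso e},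
    fun i => i.2.1, fun i => ⟨i.1, i.2.2.1⟩, fun K => ⟨?_, ?_⟩⟩
  · rintro ⟨⟨p, L, e⟩, f⟩ ⟨⟨p', L', e'⟩, f'⟩ h
    obtain ⟨rfl, h⟩ := Sigma.mk.inj_iff.1 h
    obtain ⟨rfl, h'⟩ := Sigma.mk.inj_iff.1
      (incl_comp_iso_unique (leOfHom f) (leOfHom f') e e' (eq_of_heq h))
    obtain rfl := eq_of_heq h'
    obtain rfl : f = f' := Subsingleton.elim _ _
    rfl
  · rintro ⟨p, f⟩
    obtain ⟨L, h, e, he, hf⟩ := exists_incl_comp_iso K f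
    exact ⟨⟨⟨p, L, e, he⟩, homOfLE h⟩, Sigma.ext rfl (heq_of_eq hf.symm)⟩

/-- Restriction to the poset of the subgroups in the class preserves projectives. -/
lemma projective_restrictFunctor_obj (P : Contramodule R 𝓗) [Projective P] :
    Projective ((restrictFunctor R 𝓗).obj P) := by
  have h : Retract P ((coverPresheaf P).lin R) :=
    { i := Projective.factorThru (𝟙 P) (coverHom P)
      r := coverHom P
      retract := Projective.factorThru_comp _ _ }
  have h' : Projective ((restrictFunctor R 𝓗).obj ((coverPresheaf P).lin R)) :=
    (isCoprodRepr_restrict_coverPresheaf P).projective (R := R)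
  exact (h.map (restrictFunctor R 𝓗)).projective

lemma quasiIso_restrictFunctor_map {C D : ChainComplex (Contramodule R 𝓗) ℕ} (f : C ⟶ D)
    [QuasiIso f] :
    QuasiIso (((restrictFunctor R 𝓗).mapHomologicalComplex _).map f) := by
  rw [HomologicalComplex.quasiIso_iff_evaluation]
  intro K
  exact (HomologicalComplex.quasiIso_iff_evaluation f).1 inferInstance (op K.unop.toOrbit)

end Restriction

/-! ### The cone contraction of a poset with a least element -/

section Cone

variable {P : Type u} [PartialOrder P]

/-- The chain `q < c₀ < ⋯ < cₙ`. -/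
def consSimplex {n : ℕ} (q : P) (c : Simplices P n) (h : q < c 0) : Simplices P (n + 1) :=
  OrderEmbedding.ofStrictMono (Fin.cons q c : Fin (n + 2) → P) <| by
    rw [Fin.strictMono_iff_lt_succ]
    intro i
    cases i using Fin.cases with
    | zero => exact h
    | succ j =>
      rw [← Fin.succ_castSucc, Fin.cons_succ, Fin.cons_succ]
      exact c.strictMono (Fin.castSucc_lt_succ)

/-- The chain with one element. -/
def pointSimplex (q : P) : Simplices P 0 :=
  OrderEmbedding.ofStrictMono (fun _ => q) (Subsingleton.strictMono (α := Fin 1) _)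

lemma face_zero_consSimplex {n : ℕ} (q : P) (c : Simplices P n) (h : q < c 0) :
    face 0 (consSimplex q c h) = c := rfl

lemma lt_face_zero {n : ℕ} {q : P} {c : Simplices P (n + 1)} (h : q < c 0) (i : Fin (n + 2)) :
    q < face i c 0 :=
  lt_of_lt_of_le h (c.monotone (Fin.zero_le _))

lemma face_succ_consSimplex {n : ℕ} (q : P) (c : Simplices P (n + 1)) (h : q < c 0)
    (i : Fin (n + 2)) :
    face i.succ (consSimplex q c h) = consSimplex q (face i c) (lt_face_zero h i) := by
  refine RelEmbedding.ext fun k => ?_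
  change (Fin.cons q c : Fin (n + 3) → P) (i.succ.succAbove k) =
    (Fin.cons q (face i c) : Fin (n + 2) → P) k
  cases k using Fin.cases with
  | zero => rfl
  | succ k => rw [Fin.succ_succAbove_succ, Fin.cons_succ, Fin.cons_succ]; rfl

lemma face_one_consSimplex (q : P) (c : Simplices P 0) (h : q < c 0) :
    face 1 (consSimplex q c h) = pointSimplex q := by
  refine RelEmbedding.ext fun k => ?_
  obtain rfl : k = 0 := Fin.fin_one_eq_zero k
  rfl

lemma eq_consSimplex {n : ℕ} {q : P} (c : Simplices P (n + 1)) (h : c 0 = q)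
    (h' : q < face 0 c 0) : c = consSimplex q (face 0 c) h' := by
  refine RelEmbedding.ext fun k => ?_
  cases k using Fin.cases with
  | zero => exact h
  | succ k => rfl

lemma lt_face_zero_zero {n : ℕ} (c : Simplices P (n + 1)) : c 0 < face 0 c 0 :=
  c.strictMono (show (0 : Fin (n + 2)) < Fin.succ 0 from Fin.succ_pos 0)

lemma eq_pointSimplex {q : P} (c : Simplices P 0) (h : c 0 = q) : c = pointSimplex q := by
  refine RelEmbedding.ext fun k => ?_
  obtain rfl : k = 0 := Fin.fin_one_eq_zero k
  exact h

variable (R : Type u) [CommRing R]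

lemma boundaryLin_consSimplex {n : ℕ} (q : P) (c : Simplices P (n + 1)) (h : q < c 0) :
    boundaryLin R P (n + 1) (Finsupp.single (consSimplex q c h) 1) =
      Finsupp.single c 1 - ∑ i : Fin (n + 2),
        (-1 : R) ^ (i : ℕ) • Finsupp.single (consSimplex q (face i c) (lt_face_zero h i)) 1 := by
  rw [boundaryLin_single, Fin.sum_univ_succ, face_zero_consSimplex, sub_eq_add_neg,
    ← Finset.sum_neg_distrib]
  congr 1
  · simp
  · refine Finset.sum_congr rfl fun i _ => ?_
    rw [face_succ_consSimplex, Fin.val_succ, pow_succ, mul_neg_one, neg_smul]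

lemma boundaryLin_consSimplex_zero (q : P) (c : Simplices P 0) (h : q < c 0) :
    boundaryLin R P 0 (Finsupp.single (consSimplex q c h) 1) =
      Finsupp.single c 1 - Finsupp.single (pointSimplex q) 1 := by
  rw [boundaryLin_single, Fin.sum_univ_two, face_zero_consSimplex, face_one_consSimplex,
    sub_eq_add_neg]
  simp

lemma boundaryLin_comp_lmapDomain {Q : Type u} [PartialOrder Q] (e : P ↪o Q) (n : ℕ) :
    boundaryLin R Q n ∘ₗ Finsupp.lmapDomain R R (fun c : Simplices P (n + 1) => c.trans e) =
      Finsupp.lmapDomain R R (fun c : Simplices P n => c.trans e) ∘ₗ boundaryLin R P n := by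
  refine Finsupp.lhom_ext' fun c => LinearMap.ext_ring ?_
  simp only [LinearMap.comp_apply, Finsupp.lsingle_apply, Finsupp.lmapDomain_apply,
    Finsupp.mapDomain_single]
  rw [boundaryLin_single, boundaryLin_single, ← Finsupp.lmapDomain_apply R R, map_sum]
  refine Finset.sum_congr rfl fun i _ => ?_
  rw [map_smul, Finsupp.lmapDomain_apply, Finsupp.mapDomain_single]
  rfl

lemma augmentationLin_comp_lmapDomain {Q : Type u} [PartialOrder Q] (e : P ↪o Q) :
    augmentationLin R Q ∘ₗ Finsupp.lmapDomain R R (fun c : Simplices P 0 => c.trans e) =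
      augmentationLin R P := by
  ext c : 2
  simp [augmentationLin]

variable [OrderBot P]

open Classical in
/-- The cone operator, which adds the least element to a chain if possible. -/
def coneLin (n : ℕ) : (Simplices P n →₀ R) →ₗ[R] (Simplices P (n + 1) →₀ R) :=
  Finsupp.linearCombination R fun c =>
    if h : ⊥ < c 0 then Finsupp.single (consSimplex ⊥ c h) 1 else 0

lemma coneLin_single_of_lt {n : ℕ} (c : Simplices P n) (h : ⊥ < c 0) :
    coneLin R n (Finsupp.single c 1) = Finsupp.single (consSimplex ⊥ c h) 1 := by
  simp [coneLin, h]

lemma coneLin_single_of_eq {n : ℕ} (c : Simplices P n) (h : c 0 = ⊥) :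
    coneLin R n (Finsupp.single c 1) = 0 := by
  simp [coneLin, h]

/-- If `c` starts above `⊥`, this is the formula for the boundary of a cone. If `c` starts at `⊥`,
its cone is zero and only face `0` no longer starts at `⊥`; coning that face restores `c`. -/
lemma boundaryLin_coneLin_add (n : ℕ) :
    boundaryLin R P (n + 1) ∘ₗ coneLin R (n + 1) + coneLin R n ∘ₗ boundaryLin R P n =
      LinearMap.id := by
  refine Finsupp.lhom_ext' fun c => LinearMap.ext_ring ?_
  change boundaryLin R P (n + 1) (coneLin R (n + 1) (Finsupp.single c 1)) +
    coneLin R n (boundaryLin R P n (Finsupp.single c 1)) = Finsupp.single c 1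
  rw [boundaryLin_single, map_sum]
  by_cases h : ⊥ < c 0
  · rw [coneLin_single_of_lt R c h, boundaryLin_consSimplex, sub_add_eq_add_sub, sub_eq_iff_eq_add]
    congr 1
    refine Finset.sum_congr rfl fun i _ => ?_
    rw [map_smul, coneLin_single_of_lt]
  · have h0 : c 0 = ⊥ := not_bot_lt_iff.1 h
    rw [coneLin_single_of_eq R c h0, map_zero, zero_add, Fin.sum_univ_succ]
    rw [Finset.sum_eq_zero, add_zero, map_smul, coneLin_single_of_lt R _ (h0 ▸ lt_face_zero_zero c),
      ← eq_consSimplex c h0]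
    · simp
    · intro i _
      rw [map_smul, coneLin_single_of_eq, smul_zero]
      exact h0

lemma boundaryLin_coneLin_zero_add :
    boundaryLin R P 0 ∘ₗ coneLin R 0 +
      Finsupp.lsingle (pointSimplex ⊥) ∘ₗ augmentationLin R P = LinearMap.id := by
  refine Finsupp.lhom_ext' fun c => LinearMap.ext_ring ?_
  change boundaryLin R P 0 (coneLin R 0 (Finsupp.single c 1)) +
    Finsupp.single (pointSimplex ⊥) (augmentationLin R P (Finsupp.single c 1)) = Finsupp.single c 1
  have ha : augmentationLin R P (Finsupp.single c 1) = 1 := by simp [augmentationLin]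
  rw [ha]
  by_cases h : ⊥ < c 0
  · rw [coneLin_single_of_lt R c h, boundaryLin_consSimplex_zero, sub_add_cancel]
  · have h0 : c 0 = ⊥ := not_bot_lt_iff.1 h
    rw [coneLin_single_of_eq R c h0, map_zero, zero_add, eq_pointSimplex c h0]

end Cone

/-! ### The resolution of the trivial contramodule by chains -/

section ChainModules

open Opposite

variable {Γ : Type u} [Group Γ] {𝓗 : SubgroupFamily Γ}

/-- The poset of the subgroups in the class which contain a given one. -/
abbrev MembersAbove (H : OrbitCat 𝓗) : Type u := {K : Members 𝓗 // H.stab ≤ K.1}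

instance (H : OrbitCat 𝓗) : OrderBot (MembersAbove H) where
  bot := ⟨⟨H.stab, H.mem⟩, le_rfl⟩
  bot_le K := K.2

lemma Members.conj_mul_of_mem (K : Members 𝓗) (g : Γ) {l : Γ} (hl : l ∈ K.1) :
    K.conj (g * l) = K.conj g := by
  refine Subtype.ext (Subgroup.ext fun x => ?_)
  rw [Members.mem_conj, Members.mem_conj]
  constructor
  · intro h
    simpa [mul_assoc] using mul_mem (mul_mem hl h) (inv_mem hl)
  · intro h
    simpa [mul_assoc] using mul_mem (mul_mem (inv_mem hl) h) hl

/-- The conjugates of a subgroup which contains `L`, indexed by the cosets of `L`. -/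
def cosetConj {L : OrbitCat 𝓗} (K : MembersAbove L) : Γ ⧸ L.stab → Members 𝓗 :=
  Quotient.lift (fun g => K.1.conj g) fun a b hab => by
    have h : a⁻¹ * b ∈ L.stab := QuotientGroup.leftRel_apply.1 hab
    rw [← K.1.conj_mul_of_mem a (K.2 h), mul_inv_cancel_left]

lemma cosetConj_orbitHom {H L : OrbitCat 𝓗} (g : Γ) (h : ∀ x ∈ H.stab, g⁻¹ * x * g ∈ L.stab)
    (K : MembersAbove L) :
    cosetConj K (toMap (orbitHom g h) ((1 : Γ) : Γ ⧸ H.stab)) = K.1.conj g := by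
  rw [toMap_orbitHom, one_mul]
  rfl

lemma Members.conj_le_conj_iff {K L : Members 𝓗} (g : Γ) : K.conj g ≤ L.conj g ↔ K ≤ L :=
  Subgroup.map_le_map_iff_of_injective (MulAut.conj g).injective

lemma Members.conj_conj (K : Members 𝓗) (g h : Γ) : (K.conj h).conj g = K.conj (g * h) :=
  Subtype.ext (map_conj_mul g h K.1).symm

lemma Members.conj_one (K : Members 𝓗) : K.conj 1 = K := Subtype.ext (map_conj_one K.1)

/-- A morphism `f` from `H` to `L` with `f(H) = gL` sends `K ≥ L` to `g K g⁻¹ ≥ H`. -/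
def pullAbove {H L : OrbitCat 𝓗} (f : H ⟶ L) : MembersAbove L ↪o MembersAbove H :=
  OrderEmbedding.ofMapLEIff
    (fun K => ⟨cosetConj K (toMap f ((1 : Γ) : Γ ⧸ H.stab)), by
      obtain ⟨g, hg, rfl⟩ := exists_orbitHom f
      rw [cosetConj_orbitHom]
      exact fun x hx => Members.mem_conj.2 (K.2 (hg x hx))⟩) fun K K' => by
    obtain ⟨g, hg, rfl⟩ := exists_orbitHom f
    rw [Subtype.mk_le_mk, cosetConj_orbitHom, cosetConj_orbitHom, Members.conj_le_conj_iff]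
    rfl

lemma pullAbove_orbitHom {H L : OrbitCat 𝓗} (g : Γ) (h : ∀ x ∈ H.stab, g⁻¹ * x * g ∈ L.stab)
    (K : MembersAbove L) : (pullAbove (orbitHom g h) K).1 = K.1.conj g :=
  cosetConj_orbitHom g h K

lemma pullAbove_incl {K L : Members 𝓗} (h : K ≤ L) (J : MembersAbove L.toOrbit) :
    (pullAbove (incl h) J).1 = J.1 := by
  rw [incl_eq, pullAbove_orbitHom, Members.conj_one]

lemma pullAbove_id (H : OrbitCat 𝓗) (K : MembersAbove H) : pullAbove (𝟙 H) K = K := by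
  rw [← orbitHom_one H (by simp)]
  exact Subtype.ext (by rw [pullAbove_orbitHom, Members.conj_one])

lemma pullAbove_comp {H L J : OrbitCat 𝓗} (f : H ⟶ L) (f' : L ⟶ J) (K : MembersAbove J) :
    pullAbove (f ≫ f') K = pullAbove f (pullAbove f' K) := by
  obtain ⟨g, hg, rfl⟩ := exists_orbitHom f
  obtain ⟨g', hg', rfl⟩ := exists_orbitHom f'
  refine Subtype.ext ?_
  rw [orbitHom_comp _ _ _ _ (fun x hx => by simpa [mul_assoc] using hg' _ (hg x hx)),
    pullAbove_orbitHom, pullAbove_orbitHom, pullAbove_orbitHom, Members.conj_conj]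

variable (𝓗) in
/-- The presheaf on the orbit category which sends `H` to the chains `H ≤ K₀ < ⋯ < Kₘ` in the
class. -/
def chainPresheaf (m : ℕ) : SetPresheaf (OrbitCat 𝓗) where
  obj H := Simplices (MembersAbove H) m
  map f c := c.trans (pullAbove f)
  map_id H _ := RelEmbedding.ext fun _ => pullAbove_id H _
  map_comp f g _ := RelEmbedding.ext fun _ => pullAbove_comp f g _

variable (R : Type u) [CommRing R]

variable (𝓗) in
/-- The boundary of the chain presheaves. -/
def chainBoundary (m : ℕ) : (chainPresheaf 𝓗 (m + 1)).lin R ⟶ (chainPresheaf 𝓗 m).lin R where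
  app X := ModuleCat.ofHom (boundaryLin R (MembersAbove X.unop) m)
  naturality X Y f := by
    exact ModuleCat.hom_ext (boundaryLin_comp_lmapDomain R (pullAbove f.unop) m)

variable (𝓗) in
/-- The complex of contramodules of the chains in the class. -/
def chainResolution : ChainComplex (Contramodule R 𝓗) ℕ :=
  ChainComplex.of (fun m => (chainPresheaf 𝓗 m).lin R) (chainBoundary 𝓗 R) fun m => by
    refine NatTrans.ext (funext fun X => ModuleCat.hom_ext ?_)
    exact boundaryLin_comp R m

lemma chainResolution_d (m : ℕ) : (chainResolution 𝓗 R).d (m + 1) m = chainBoundary 𝓗 R m := by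
  simp [chainResolution]

variable (𝓗) in
/-- The augmentation of the complex of contramodules of the chains in the class. -/
def chainAugmentation : (chainPresheaf 𝓗 0).lin R ⟶ trivialContramodule R 𝓗 where
  app X := ModuleCat.ofHom (augmentationLin R (MembersAbove X.unop))
  naturality X Y f := by
    exact ModuleCat.hom_ext (augmentationLin_comp_lmapDomain R (pullAbove f.unop))

variable (𝓗) in
/-- The resolution of the trivial contramodule by chains in the class. -/
def chainResolutionπ :
    chainResolution 𝓗 R ⟶ (ChainComplex.single₀ _).obj (trivialContramodule R 𝓗) :=
  (ChainComplex.toSingle₀Equiv _ _).symm ⟨chainAugmentation 𝓗 R, by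
    rw [chainResolution_d]
    refine NatTrans.ext (funext fun X => ModuleCat.hom_ext ?_)
    exact augmentationLin_comp R⟩

/-- The chains over the elements of the poset form a coproduct of representables. -/
lemma isCoprodRepr_restrict_chainPresheaf (m : ℕ) :
    ((chainPresheaf 𝓗 m).restrict (orbitIncl 𝓗)).IsCoprodRepr := by
  have hval {K L : Members 𝓗} (f : K ⟶ L) (c : Simplices (MembersAbove L.toOrbit) m)
      (i : Fin (m + 1)) :
      ((show Simplices (MembersAbove K.toOrbit) m from
        ((chainPresheaf 𝓗 m).restrict (orbitIncl 𝓗)).map f c) i).1 = (c i).1 := pullAbove_incl (leOfHom f) (c i)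
  -- A chain `c` lies above `K` exactly when `K ≤ c 0`, so `c` viewed above its own least term is a
  -- universal element, and the presheaf is the coproduct over `c` of the representables of `c 0`.
  let y (c : Simplices (Members 𝓗) m) : Simplices (MembersAbove (c 0).toOrbit) m :=
    OrderEmbedding.ofMapLEIff (fun i => ⟨c i, c.monotone (Fin.zero_le i)⟩) fun i j =>
      c.le_iff_le
  refine ⟨Simplices (Members 𝓗) m, fun c => c 0, y, fun K => ⟨?_, ?_⟩⟩
  · rintro ⟨c, f⟩ ⟨c', f'⟩ h
    have h' : c = c' := by
      refine RelEmbedding.ext fun i => ?_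
      have h1 := congrArg (fun d : Simplices (MembersAbove K.toOrbit) m => (d i).1) h
      exact (hval f (y c) i).symm.trans (h1.trans (hval f' (y c') i))
    subst h'
    obtain rfl : f = f' := Subsingleton.elim _ _
    rfl
  · intro (c : Simplices (MembersAbove K.toOrbit) m)
    let c' : Simplices (Members 𝓗) m :=
      OrderEmbedding.ofMapLEIff (fun i => (c i).1) fun i j => c.le_iff_le
    have h0 : K ≤ c' 0 := (c 0).2
    refine ⟨⟨c', homOfLE h0⟩, RelEmbedding.ext fun i => Subtype.ext ?_⟩
    exact hval (homOfLE h0) (y c') i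

end ChainModules

section Contraction

variable {V : Type*} [Category V] [Abelian V]

/-- A morphism to a complex concentrated in degree `0` is a quasi-isomorphism if there is a
contraction. -/
lemma quasiIso_of_contraction {C D : ChainComplex V ℕ} (π : C ⟶ D)
    (hD : ∀ n, Limits.IsZero (D.X (n + 1))) (t : D.X 0 ⟶ C.X 0) (s : ∀ n, C.X n ⟶ C.X (n + 1))
    (ht : t ≫ π.f 0 = 𝟙 (D.X 0)) (h0 : s 0 ≫ C.d 1 0 + π.f 0 ≫ t = 𝟙 (C.X 0))
    (hs : ∀ n, s (n + 1) ≫ C.d (n + 2) (n + 1) + C.d (n + 1) n ≫ s n = 𝟙 (C.X (n + 1))) :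
    QuasiIso π := by
  let t' : D ⟶ C :=
    { f := fun n => match n with
        | 0 => t
        | _ + 1 => 0
      comm' := fun i j hij => by
        obtain rfl : j + 1 = i := hij
        exact (hD j).eq_of_src _ _ }
  let σ (i j : ℕ) : C.X i ⟶ C.X j :=
    if h : i + 1 = j then s i ≫ eqToHom (by rw [h]) else 0
  have hσ (i : ℕ) : σ i (i + 1) = s i := by simp [σ]
  let H : Homotopy (𝟙 C) (π ≫ t') :=
    { hom := σ
      zero := fun i j h => dif_neg h
      comm := fun i => by
        cases i with
        | zero =>
          rw [Homotopy.dNext_zero_chainComplex, Homotopy.prevD_chainComplex, hσ, zero_add,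
            HomologicalComplex.comp_f]
          exact h0.symm
        | succ n =>
          rw [Homotopy.dNext_succ_chainComplex, Homotopy.prevD_chainComplex, hσ, hσ,
            HomologicalComplex.comp_f]
          have h1 : t'.f (n + 1) = 0 := rfl
          rw [h1, Limits.comp_zero, add_zero]
          exact (hs n).symm.trans (add_comm _ _) }
  let e : HomotopyEquiv C D :=
    { hom := π
      inv := t'
      homotopyHomInvId := H.symm
      homotopyInvHomId := Homotopy.ofEq (by
        ext n
        cases n with
        | zero => exact ht
        | succ n => exact (hD n).eq_of_src _ _) }
  exact e.quasiIso_hom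

end Contraction

section ChainModules

open Opposite

variable {Γ : Type u} [Group Γ] {𝓗 : SubgroupFamily Γ} (R : Type u) [CommRing R]

lemma augmentationLin_pointSimplex {P : Type u} [PartialOrder P] (q : P) :
    augmentationLin R P (Finsupp.single (pointSimplex q) 1) = 1 := by
  simp [augmentationLin]

lemma chainResolutionπ_f_zero : (chainResolutionπ 𝓗 R).f 0 = chainAugmentation 𝓗 R :=
  ChainComplex.toSingle₀Equiv_symm_apply_f_zero _ _

/-- At each `H` this is the augmented chain complex of a poset with least element `H`, which the
cone operator contracts. -/
instance quasiIso_chainResolutionπ : QuasiIso (chainResolutionπ 𝓗 R) := by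
  rw [HomologicalComplex.quasiIso_iff_evaluation]
  intro X
  have hd (n : ℕ) : ((((evaluation _ _).obj X).mapHomologicalComplex _).obj
      (chainResolution 𝓗 R)).d (n + 1) n =
        ModuleCat.ofHom (boundaryLin R (MembersAbove X.unop) n) :=
    congrArg (fun f => f.app X) (chainResolution_d R n)
  have hπ : ((((evaluation _ _).obj X).mapHomologicalComplex _).map
      (chainResolutionπ 𝓗 R)).f 0 =
        ModuleCat.ofHom (augmentationLin R (MembersAbove X.unop)) :=
    congrArg (fun f => NatTrans.app f X) (chainResolutionπ_f_zero R)
  refine quasiIso_of_contraction _ (fun n => ?_)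
    (ModuleCat.ofHom (Finsupp.lsingle (pointSimplex (⊥ : MembersAbove X.unop))))
    (fun n => ModuleCat.ofHom (coneLin R n)) ?_ ?_ fun n => ?_
  · exact Functor.map_isZero ((evaluation _ _).obj X)
      (HomologicalComplex.isZero_single_obj_X (ComplexShape.down ℕ) 0
        (trivialContramodule R 𝓗) (n + 1) n.succ_ne_zero)
  · rw [hπ]
    refine ModuleCat.hom_ext (LinearMap.ext_ring ?_)
    exact augmentationLin_pointSimplex R _
  · rw [hd, hπ]
    exact ModuleCat.hom_ext (boundaryLin_coneLin_zero_add R)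
  · rw [hd, hd]
    exact ModuleCat.hom_ext (boundaryLin_coneLin_add R n)

end ChainModules

/-! ### The tops of the chain contramodules -/

section TopOfChains

open Opposite

variable {Γ : Type u} [Group Γ] {𝓗 : SubgroupFamily Γ} (R : Type u) [CommRing R]

/-- If the conjugate of `y` were `K`, then `g L g⁻¹`, contained in it, would be at most `K`, and `f`
would be invertible. -/
lemma bot_lt_pullAbove {K L : OrbitCat 𝓗} (f : K ⟶ L) (hf : ¬ IsIso f) (y : MembersAbove L) :
    ⊥ < pullAbove f y := by
  obtain ⟨g, hg, rfl⟩ := exists_orbitHom f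
  rw [bot_lt_iff_ne_bot]
  intro h
  refine hf ((isIso_orbitHom_iff _ _).2 fun x hx => ?_)
  have h1 := congrArg Subtype.val h
  rw [pullAbove_orbitHom] at h1
  have h2 : x ∈ (y.1.conj g).1 := Members.mem_conj.2 (y.2 hx)
  rw [h1] at h2
  exact h2

/-- The radical of the module of chains above `K`. -/
def chainRad (m : ℕ) (K : OrbitCat 𝓗) : Submodule R (Simplices (MembersAbove K) m →₀ R) :=
  rad ((chainPresheaf 𝓗 m).lin R) K

/-- Chains pulled back along a non-isomorphism start strictly above `K`; conversely, a chain with `K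
< σ 0` is restricted along the projection to `Γ/(σ 0)`. Hence the chains starting at `K` form a
basis of the quotient. -/
lemma chainRad_eq_supported (m : ℕ) (K : OrbitCat 𝓗) :
    chainRad R m K = Finsupp.supported R R {σ : Simplices (MembersAbove K) m | ⊥ < σ 0} := by
  apply le_antisymm
  · refine rad_le_iff.2 ?_
    intro L f hf x
    change Finsupp.lmapDomain R R (fun c : Simplices (MembersAbove L) m => c.trans (pullAbove f)) x
      ∈ Finsupp.supported R R {σ : Simplices (MembersAbove K) m | ⊥ < σ 0}
    rw [Finsupp.mem_supported]
    classical
    refine (Finset.coe_subset.2 Finsupp.mapDomain_support).trans ?_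
    intro σ hσ
    obtain ⟨c, -, rfl⟩ := Finset.mem_image.1 hσ
    exact bot_lt_pullAbove f hf (c 0)
  · rw [Finsupp.supported_eq_span_single, Submodule.span_le]
    rintro _ ⟨σ, hσ, rfl⟩
    let K' : Members 𝓗 := ⟨K.stab, K.mem⟩
    have hlt : K' < (σ 0).1 := hσ
    let σ' : Simplices (MembersAbove (σ 0).1.toOrbit) m :=
      OrderEmbedding.ofMapLEIff (fun i => ⟨(σ i).1, σ.monotone (Fin.zero_le i)⟩) fun i j =>
        σ.le_iff_le
    have h := map_mem_rad ((chainPresheaf 𝓗 m).lin R) (incl hlt.le) (not_isIso_incl hlt)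
      (Finsupp.single σ' (1 : R))
    have h' : (chainPresheaf 𝓗 m).map (incl hlt.le) σ' = σ :=
      RelEmbedding.ext fun i => Subtype.ext (pullAbove_incl hlt.le _)
    have h'' := (chainPresheaf 𝓗 m).lin_map_single R (incl hlt.le) σ' 1
    rw [h'] at h''
    exact (congrArg (fun z => z ∈ rad ((chainPresheaf 𝓗 m).lin R) K) h'').mp h

lemma bijective_mkQ_lmapDomain {m : ℕ} {K : OrbitCat 𝓗} {ι : Type u}
    (f : ι → Simplices (MembersAbove K) m) (hf : Function.Injective f)
    (hf' : ∀ i, f i 0 = ⊥) (hf'' : ∀ σ : Simplices (MembersAbove K) m, σ 0 = ⊥ → ∃ i, f i = σ) :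
    Function.Bijective ((chainRad R m K).mkQ ∘ₗ
      (Finsupp.lmapDomain R R f : _ →ₗ[R] Simplices (MembersAbove K) m →₀ R)) := by
  constructor
  · rw [← LinearMap.ker_eq_bot, LinearMap.ker_eq_bot']
    intro x hx
    have h : Finsupp.mapDomain f x ∈ chainRad R m K :=
      (Submodule.Quotient.mk_eq_zero _).1 hx
    rw [chainRad_eq_supported, Finsupp.mem_supported] at h
    ext i
    rw [← Finsupp.mapDomain_apply hf x i]
    by_contra hne
    have h1 : ⊥ < f i 0 := h (Finsupp.mem_support_iff.2 hne)
    exact h1.ne' (hf' i)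
  · rw [← LinearMap.range_eq_top, eq_top_iff]
    rintro z -
    obtain ⟨x, rfl⟩ := Submodule.mkQ_surjective _ z
    let x' : Simplices (MembersAbove K) m →₀ R := x
    change (chainRad R m K).mkQ x' ∈ _
    induction x' using Finsupp.induction_linear with
    | zero => exact (map_zero (chainRad R m K).mkQ) ▸ zero_mem _
    | add a b ha hb =>
      exact (map_add (chainRad R m K).mkQ a b) ▸ add_mem ha hb
    | single σ r =>
      by_cases h : ⊥ < σ 0
      · have h0 : (chainRad R m K).mkQ (Finsupp.single σ r) = 0 := by
          refine (Submodule.Quotient.mk_eq_zero _).2 ?_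
          rw [chainRad_eq_supported]
          exact Finsupp.single_mem_supported R r h
        exact h0 ▸ zero_mem _
      · obtain ⟨i, rfl⟩ := hf'' σ (not_bot_lt_iff.1 h)
        exact ⟨Finsupp.single i r, congrArg _ Finsupp.mapDomain_single⟩

variable (K : OrbitCat 𝓗)

/-- The inclusion of the poset of the strictly larger subgroups. -/
def toMembersAbove : Above 𝓗 K.stab ↪o MembersAbove K :=
  OrderEmbedding.ofMapLEIff (fun x => ⟨⟨x.1, x.2.1⟩, x.2.2.le⟩) fun _ _ => Iff.rfl

variable {K} in
lemma bot_lt_trans_toMembersAbove {m : ℕ} (c : Simplices (Above 𝓗 K.stab) m) :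
    ⊥ < (c.trans (toMembersAbove K)) 0 := (c 0).2.2

variable {K} in
/-- The chain which starts with the least element and continues with the given one. -/
def coneAbove {m : ℕ} (c : Simplices (Above 𝓗 K.stab) m) : Simplices (MembersAbove K) (m + 1) :=
  consSimplex ⊥ (c.trans (toMembersAbove K)) (bot_lt_trans_toMembersAbove c)

lemma coneAbove_injective {m : ℕ} : Function.Injective (coneAbove (K := K) (m := m)) := by
  intro c c' h
  refine RelEmbedding.ext fun i => (toMembersAbove K).injective ?_
  exact congrArg (fun σ : Simplices (MembersAbove K) (m + 1) => σ i.succ) h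

lemma exists_coneAbove_eq {m : ℕ} (σ : Simplices (MembersAbove K) (m + 1)) (h : σ 0 = ⊥) :
    ∃ c, coneAbove c = σ := by
  have hlt (i : Fin (m + 1)) : ⊥ < σ i.succ := h ▸ σ.strictMono (Fin.succ_pos i)
  let c : Simplices (Above 𝓗 K.stab) m :=
    OrderEmbedding.ofMapLEIff (fun i => ⟨(σ i.succ).1.1, (σ i.succ).1.2, hlt i⟩) fun i j =>
      (σ.le_iff_le (a := i.succ) (b := j.succ)).trans Fin.succ_le_succ_iff
  refine ⟨c, RelEmbedding.ext fun i => ?_⟩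
  cases i using Fin.cases with
  | zero => exact h.symm
  | succ i => rfl

lemma mkQ_single_eq_zero {m : ℕ} (σ : Simplices (MembersAbove K) m) (h : ⊥ < σ 0) :
    (chainRad R m K).mkQ (Finsupp.single σ 1) = 0 := by
  refine (Submodule.Quotient.mk_eq_zero _).2 ?_
  rw [chainRad_eq_supported]
  exact Finsupp.single_mem_supported R 1 h

lemma boundaryLin_mem_chainRad {m : ℕ} {x : Simplices (MembersAbove K) (m + 1) →₀ R}
    (hx : x ∈ chainRad R (m + 1) K) : boundaryLin R _ m x ∈ chainRad R m K :=
  app_mem_rad (chainBoundary 𝓗 R m) hx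

/-- The boundary on the quotients by the radicals. -/
def topBoundaryLin (m : ℕ) :
    ((Simplices (MembersAbove K) (m + 1) →₀ R) ⧸ chainRad R (m + 1) K) →ₗ[R]
      (Simplices (MembersAbove K) m →₀ R) ⧸ chainRad R m K :=
  Submodule.mapQ _ _ (boundaryLin R _ m) fun _ => boundaryLin_mem_chainRad R K

/-- The comparison map in degree `0`. -/
def weylToTopZeroLin : R →ₗ[R] (Simplices (MembersAbove K) 0 →₀ R) ⧸ chainRad R 0 K :=
  (chainRad R 0 K).mkQ ∘ₗ Finsupp.lsingle (pointSimplex ⊥)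

/-- The comparison map in positive degrees. -/
def weylToTopSuccLin (m : ℕ) : (Simplices (Above 𝓗 K.stab) m →₀ R) →ₗ[R]
    (Simplices (MembersAbove K) (m + 1) →₀ R) ⧸ chainRad R (m + 1) K :=
  -- Modulo the radical, coning anticommutes with the boundary; the sign turns this into a chain
  -- map.
  (-1 : Rˣ) ^ (m + 1) • ((chainRad R (m + 1) K).mkQ ∘ₗ Finsupp.lmapDomain R R coneAbove)

lemma weylToTopSuccLin_single {m : ℕ} (c : Simplices (Above 𝓗 K.stab) m) :
    weylToTopSuccLin R K m (Finsupp.single c 1) =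
      (-1 : R) ^ (m + 1) • (chainRad R (m + 1) K).mkQ (Finsupp.single (coneAbove c) 1) := by
  simp [weylToTopSuccLin, Units.smul_def]

lemma topBoundaryLin_comp_weylToTopSuccLin_zero :
    topBoundaryLin R K 0 ∘ₗ weylToTopSuccLin R K 0 =
      weylToTopZeroLin R K ∘ₗ augmentationLin R (Above 𝓗 K.stab) := by
  refine Finsupp.lhom_ext' fun c => LinearMap.ext_ring ?_
  simp only [LinearMap.comp_apply, Finsupp.lsingle_apply]
  rw [weylToTopSuccLin_single, map_smul]
  have ha : augmentationLin R (Above 𝓗 K.stab) (Finsupp.single c 1) = 1 := by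
    simp [augmentationLin]
  have hb : topBoundaryLin R K 0 ((chainRad R 1 K).mkQ (Finsupp.single (coneAbove c) 1)) =
      - (chainRad R 0 K).mkQ (Finsupp.single (pointSimplex ⊥) 1) := by
    change (chainRad R 0 K).mkQ (boundaryLin R _ 0 (Finsupp.single (coneAbove c) 1)) = _
    rw [coneAbove, boundaryLin_consSimplex_zero, map_sub, mkQ_single_eq_zero, zero_sub]
    exact bot_lt_trans_toMembersAbove c
  rw [ha, hb]
  simp [weylToTopZeroLin]

/-- In the boundary of the cone over `c`, the face `c` lies in the radical, and the other faces are
cones over faces of `c` with index shifted by one, hence with opposite sign. -/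
lemma topBoundaryLin_comp_weylToTopSuccLin_succ (m : ℕ) :
    topBoundaryLin R K (m + 1) ∘ₗ weylToTopSuccLin R K (m + 1) =
      weylToTopSuccLin R K m ∘ₗ boundaryLin R (Above 𝓗 K.stab) m := by
  refine Finsupp.lhom_ext' fun c => LinearMap.ext_ring ?_
  simp only [LinearMap.comp_apply, Finsupp.lsingle_apply]
  rw [weylToTopSuccLin_single, map_smul, boundaryLin_single, map_sum]
  have hb : topBoundaryLin R K (m + 1)
      ((chainRad R (m + 2) K).mkQ (Finsupp.single (coneAbove c) 1)) =
      - ∑ i : Fin (m + 2), (-1 : R) ^ (i : ℕ) •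
        (chainRad R (m + 1) K).mkQ (Finsupp.single (coneAbove (face i c)) 1) := by
    change (chainRad R (m + 1) K).mkQ (boundaryLin R _ (m + 1) (Finsupp.single (coneAbove c) 1)) = _
    rw [coneAbove, boundaryLin_consSimplex, map_sub, mkQ_single_eq_zero, zero_sub, map_sum]
    · simp only [map_smul]
      rfl
    · exact bot_lt_trans_toMembersAbove c
  rw [hb, pow_succ, mul_neg_one, neg_smul_neg, Finset.smul_sum]
  refine Finset.sum_congr rfl fun i _ => ?_
  rw [map_smul, weylToTopSuccLin_single, smul_comm]

lemma bijective_weylToTopZeroLin : Function.Bijective (weylToTopZeroLin R K) := by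
  have h := bijective_mkQ_lmapDomain R
    (fun _ : PUnit => (pointSimplex ⊥ : Simplices (MembersAbove K) 0))
    (fun _ _ _ => rfl) (fun _ => rfl) fun σ hσ => ⟨⟨⟩, (eq_pointSimplex σ hσ).symm⟩
  have e : ⇑(weylToTopZeroLin R K) = ((chainRad R 0 K).mkQ ∘ₗ Finsupp.lmapDomain R R
      (fun _ : PUnit => (pointSimplex ⊥ : Simplices (MembersAbove K) 0))) ∘
        Finsupp.single PUnit.unit := by
    funext r
    exact congrArg (chainRad R 0 K).mkQ (Finsupp.mapDomain_single (a := PUnit.unit)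
      (f := fun _ : PUnit => (pointSimplex ⊥ : Simplices (MembersAbove K) 0))).symm
  rw [e]
  exact h.comp ⟨Finsupp.single_injective _, fun x => ⟨_, (Finsupp.unique_single x).symm⟩⟩

lemma bijective_weylToTopSuccLin (m : ℕ) : Function.Bijective (weylToTopSuccLin R K m) :=
  (MulAction.bijective ((-1 : Rˣ) ^ (m + 1))).comp <|
    bijective_mkQ_lmapDomain R coneAbove (coneAbove_injective K) (fun _ => rfl)
      (exists_coneAbove_eq K)

end TopOfChains

/-! ### The tops of the chain resolution as the Weyl complexes -/

section Comparison

open Opposite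

variable {Γ : Type u} [Group Γ] {𝓗 : SubgroupFamily Γ} (R : Type u) [CommRing R] (K : OrbitCat 𝓗)

lemma pullAbove_normalizerHom_bot (n : Subgroup.normalizer (K.stab : Set Γ)) :
    pullAbove (normalizerHom K n) ⊥ = ⊥ := by
  refine Subtype.ext ((pullAbove_orbitHom _ _ _).trans (Subtype.ext ?_))
  exact Subgroup.mem_normalizer_iff_map_conj_eq.1 n.2

lemma pullAbove_normalizerHom_toMembersAbove (n : Subgroup.normalizer (K.stab : Set Γ))
    (x : Above 𝓗 K.stab) : pullAbove (normalizerHom K n) (toMembersAbove K x) =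
      toMembersAbove K (normalizerAction 𝓗 K.stab n x) :=
  Subtype.ext (pullAbove_orbitHom _ _ _)

lemma coneAbove_actSimplex {m : ℕ} (n : Subgroup.normalizer (K.stab : Set Γ))
    (c : Simplices (Above 𝓗 K.stab) m) :
    coneAbove (actSimplex (normalizerAction 𝓗 K.stab n) c) =
      (coneAbove c).trans (pullAbove (normalizerHom K n)) := by
  refine RelEmbedding.ext fun i => ?_
  cases i using Fin.cases with
  | zero => exact (pullAbove_normalizerHom_bot K n).symm
  | succ i => exact (pullAbove_normalizerHom_toMembersAbove K n (c i)).symm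

variable [IsEI 𝓗]

/-- The comparison map in degree `0`. -/
def weylToTopZero : Rep.of (Representation.trivial R (Weyl K.stab) R) ⟶
    (topRep R K).obj ((chainPresheaf 𝓗 0).lin R) :=
  Rep.ofHom ⟨weylToTopZeroLin R K, fun g => by
    induction g using QuotientGroup.induction_on with
    | _ n =>
      refine LinearMap.ext_ring ?_
      change (chainRad R 0 K).mkQ (Finsupp.single (pointSimplex ⊥) 1) =
        (chainRad R 0 K).mkQ (Finsupp.mapDomain
          (fun c : Simplices (MembersAbove K) 0 => c.trans (pullAbove (normalizerHom K n)))
          (Finsupp.single (pointSimplex ⊥) 1))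
      rw [Finsupp.mapDomain_single]
      congr 3
      refine RelEmbedding.ext fun i => ?_
      exact (pullAbove_normalizerHom_bot K n).symm⟩

/-- The comparison map in positive degrees. -/
def weylToTopSucc (m : ℕ) : Rep.of (simplexRep R (weylAction 𝓗 K.stab) m) ⟶
    (topRep R K).obj ((chainPresheaf 𝓗 (m + 1)).lin R) :=
  Rep.ofHom ⟨weylToTopSuccLin R K m, fun g => by
    induction g using QuotientGroup.induction_on with
    | _ n =>
      refine Finsupp.lhom_ext' fun c => LinearMap.ext_ring ?_
      change weylToTopSuccLin R K m (Finsupp.mapDomain (actSimplex (normalizerAction 𝓗 K.stab n))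
          (Finsupp.single c 1)) =
        weylRep ((topFunctor R 𝓗).obj ((chainPresheaf 𝓗 (m + 1)).lin R)) K (n : Weyl K.stab)
          (weylToTopSuccLin R K m (Finsupp.single c 1))
      rw [Finsupp.mapDomain_single, weylToTopSuccLin_single, weylToTopSuccLin_single,
        coneAbove_actSimplex]
      refine Eq.trans ?_ (map_smul (weylRep ((topFunctor R 𝓗).obj
        ((chainPresheaf 𝓗 (m + 1)).lin R)) K (n : Weyl K.stab)) _ _).symm
      refine congrArg (fun z => (-1 : R) ^ (m + 1) • z) ?_
      exact congrArg (chainRad R (m + 1) K).mkQ (Finsupp.mapDomain_single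
        (f := fun c : Simplices (MembersAbove K) (m + 1) =>
          c.trans (pullAbove (normalizerHom K n)))).symm⟩

lemma isIso_of_bijective_hom {G : Type u} [Group G] {V W : Rep.{u} R G} (f : V ⟶ W)
    (hf : Function.Bijective f.hom) : IsIso f := by
  have : Mono f := (Rep.mono_iff_injective f).2 hf.1
  have : Epi f := (Rep.epi_iff_surjective f).2 hf.2
  exact isIso_of_mono_of_epi f

instance isIso_weylToTopZero : IsIso (weylToTopZero R K) :=
  isIso_of_bijective_hom R _ (bijective_weylToTopZeroLin R K)

instance isIso_weylToTopSucc (m : ℕ) : IsIso (weylToTopSucc R K m) :=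
  isIso_of_bijective_hom R _ (bijective_weylToTopSuccLin R K m)

/-- The complex of the tops of the chain modules. -/
abbrev topChainComplex : ChainComplex (Rep.{u} R (Weyl K.stab)) ℕ :=
  ((topRep R K).mapHomologicalComplex _).obj (chainResolution 𝓗 R)

lemma topChainComplex_d (m : ℕ) :
    (topChainComplex R K).d (m + 1) m = (topRep R K).map (chainBoundary 𝓗 R m) :=
  congrArg (fun f => (topRep R K).map f) (chainResolution_d R m)

lemma posetComplex_d {P : Type u} [PartialOrder P] {G : Type u} [Group G] (ρ : G →* (P ≃o P))
    (m : ℕ) : (posetComplex R ρ).d (m + 1) m = boundary R ρ m := by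
  simp [posetComplex]

/-- The comparison map from the complex of the Weyl group to the complex of the tops of the chain
modules. -/
def weylToTop : weylComplex R 𝓗 K.stab ⟶ topChainComplex R K where
  f n := match n with
    | 0 => weylToTopZero R K
    | m + 1 => weylToTopSucc R K m
  comm' i j hij := by
    obtain rfl : j + 1 = i := hij
    rw [topChainComplex_d]
    cases j with
    | zero =>
      have h : (weylComplex R 𝓗 K.stab).d 1 0 = augmentation R (weylAction 𝓗 K.stab) := rfl
      rw [h]
      refine Rep.hom_ext (Representation.IntertwiningMap.ext ?_)
      exact topBoundaryLin_comp_weylToTopSuccLin_zero R K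
    | succ m =>
      have h : (weylComplex R 𝓗 K.stab).d (m + 2) (m + 1) = boundary R (weylAction 𝓗 K.stab) m :=
        posetComplex_d R _ m
      rw [h]
      refine Rep.hom_ext (Representation.IntertwiningMap.ext ?_)
      exact topBoundaryLin_comp_weylToTopSuccLin_succ R K m

instance isIso_weylToTop : IsIso (weylToTop R K) := by
  have (n : ℕ) : IsIso ((weylToTop R K).f n) := by
    cases n with
    | zero => exact isIso_weylToTopZero R K
    | succ m => exact isIso_weylToTopSucc R K m
  exact HomologicalComplex.Hom.isIso_of_components _

end Comparison

section HomotopyInvariance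

variable {A : Type*} [Category A] [Abelian A]

lemma quasiIso_of_homotopy {C D : ChainComplex A ℕ} {f g : C ⟶ D} (h : Homotopy f g)
    [QuasiIso g] : QuasiIso f := by
  rw [quasiIso_iff]
  intro i
  rw [quasiIsoAt_iff_isIso_homologyMap, h.homologyMap_eq i]
  infer_instance

end HomotopyInvariance

/-! ### Tops of quasi-isomorphisms between complexes with projective restrictions -/

section PosetTop

open Opposite

variable (R : Type u) [CommRing R] {X : Type u} [PartialOrder X]

/-- The span of the images of the values at the larger elements. -/
def posetRad (N : Xᵒᵖ ⥤ ModuleCat.{u} R) (x : X) : Submodule R (N.obj (op x)) :=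
  ⨆ y : {y : X // x < y}, LinearMap.range (N.map (homOfLE y.2.le).op).hom

lemma app_mem_posetRad {M N : Xᵒᵖ ⥤ ModuleCat.{u} R} (η : M ⟶ N) {x : X} :
    posetRad R M x ≤ (posetRad R N x).comap (η.app (op x)).hom := by
  refine iSup_le fun y => ?_
  rintro _ ⟨z, rfl⟩
  refine Submodule.mem_iSup_of_mem y ⟨η.app (op y.1) z, ?_⟩
  exact (ConcreteCategory.congr_hom (η.naturality (homOfLE y.2.le).op) z).symm

/-- The quotient of the value at an element by the images of the values at the larger elements. -/
def posetTop (x : X) : (Xᵒᵖ ⥤ ModuleCat.{u} R) ⥤ ModuleCat.{u} R where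
  obj N := ModuleCat.of R (N.obj (op x) ⧸ posetRad R N x)
  map η := ModuleCat.ofHom (Submodule.mapQ _ _ (η.app (op x)).hom (app_mem_posetRad R η))
  map_id N := by
    refine ModuleCat.hom_ext (Submodule.linearMap_qext _ ?_)
    rfl
  map_comp f g := by
    refine ModuleCat.hom_ext (Submodule.linearMap_qext _ ?_)
    rfl

instance (x : X) : (posetTop R x).Additive where
  map_add := by
    intros
    refine ModuleCat.hom_ext (Submodule.linearMap_qext _ ?_)
    rfl

variable {Γ : Type u} [Group Γ] {𝓗 : SubgroupFamily Γ} [IsEI 𝓗] (K : Members 𝓗)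

/-- The top of a contramodule depends as a module only on the restriction to the poset of the
subgroups in the class. -/
def topRepForgetIso : topRep R K.toOrbit ⋙ forget₂ (Rep.{u} R (Weyl K.1)) (ModuleCat.{u} R) ≅
    restrictFunctor R 𝓗 ⋙ posetTop R K :=
  NatIso.ofComponents
    (fun M => (Submodule.quotEquivOfEq (rad M K.toOrbit)
      (posetRad R ((restrictFunctor R 𝓗).obj M) K) (rad_toOrbit M K)).toModuleIso)
    fun _ => ModuleCat.hom_ext (Submodule.linearMap_qext _ rfl)

/-- The tops of a quasi-isomorphism between complexes with projective restrictions form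
quasi-isomorphisms. -/
lemma quasiIso_topRep_map {C D : ChainComplex (Contramodule R 𝓗) ℕ}
    (hC : ∀ n, Projective ((restrictFunctor R 𝓗).obj (C.X n)))
    (hD : ∀ n, Projective ((restrictFunctor R 𝓗).obj (D.X n))) (f : C ⟶ D) [QuasiIso f]
    (K : OrbitCat 𝓗) : QuasiIso (((topRep R K).mapHomologicalComplex _).map f) := by
  let K' : Members 𝓗 := ⟨K.stab, K.mem⟩
  let F := forget₂ (Rep.{u} R (Weyl K.stab)) (ModuleCat.{u} R)
  rw [← HomologicalComplex.quasiIso_map_iff_of_preservesHomology _ F]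
  let C' := ((restrictFunctor R 𝓗).mapHomologicalComplex (ComplexShape.down ℕ)).obj C
  let D' := ((restrictFunctor R 𝓗).mapHomologicalComplex (ComplexShape.down ℕ)).obj D
  let f' : C' ⟶ D' := ((restrictFunctor R 𝓗).mapHomologicalComplex _).map f
  have hC' (n : ℕ) : Projective (C'.X n) := hC n
  have hD' (n : ℕ) : Projective (D'.X n) := hD n
  have hf' : QuasiIso f' := quasiIso_restrictFunctor_map f
  -- A quasi-isomorphism of complexes of projectives is a homotopy equivalence, which the additive
  -- functor `posetTop` preserves although it need not be exact.
  obtain ⟨e, he⟩ := (ChainComplex.quasiIso_iff_of_projective f').1 hf'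
  have h1 : QuasiIso (((posetTop R K').mapHomologicalComplex _).map f') := by
    rw [← he]
    exact ((posetTop R K').mapHomotopyEquiv e).quasiIso_hom
  let i := NatIso.mapHomologicalComplex (topRepForgetIso R K') (ComplexShape.down ℕ)
  exact ((HomologicalComplex.quasiIso _ _).arrow_mk_iso_iff
    (((Functor.mapArrowFunctor _ _).mapIso i).app (Arrow.mk f))).2 h1

variable {R}

/-- The tops of a projective resolution of the trivial contramodule form a projective resolution of
the complex of the Weyl group. -/
lemma exists_quasiIso_topRep (P : ProjectiveResolution (trivialContramodule R 𝓗))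
    (K : OrbitCat 𝓗) :
    ∃ q : ((topRep R K).mapHomologicalComplex _).obj P.complex ⟶ weylComplex R 𝓗 K.stab,
      QuasiIso q := by
  -- Only `P` must be projective here; for the chains, projectivity after restriction suffices to
  -- pass to tops.
  obtain ⟨φ, ⟨h⟩⟩ := exists_lift_quasiIso P.projective (chainResolutionπ 𝓗 R) P.π
  have : QuasiIso (φ ≫ chainResolutionπ 𝓗 R) := quasiIso_of_homotopy h
  have hφ : QuasiIso φ := quasiIso_of_comp_right φ (chainResolutionπ 𝓗 R)
  have hC (n : ℕ) : Projective ((restrictFunctor R 𝓗).obj ((chainResolution 𝓗 R).X n)) :=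
    (isCoprodRepr_restrict_chainPresheaf n).projective (R := R)
  have := quasiIso_topRep_map R (fun n => projective_restrictFunctor_obj (P.complex.X n)) hC φ K
  exact ⟨((topRep R K).mapHomologicalComplex _).map φ ≫ inv (weylToTop R K), inferInstance⟩

end PosetTop

/-! ### Splitting of syzygies and comparison of lengths -/

section SplitMono

variable {A B : Type*} [Category A] [Abelian A] [Category B] [Abelian B]

lemma homotopy_id_comm_zero {P : ChainComplex A ℕ} {φ : P ⟶ P} (h : Homotopy (𝟙 P) φ)
    (hφ : φ.f 0 = 0) : 𝟙 (P.X 0) = h.hom 0 1 ≫ P.d 1 0 := by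
  have h1 := h.comm 0
  rw [Homotopy.dNext_zero_chainComplex, Homotopy.prevD_chainComplex, hφ, zero_add, add_zero] at h1
  exact h1

lemma homotopy_id_comm_succ {P : ChainComplex A ℕ} {φ : P ⟶ P} (h : Homotopy (𝟙 P) φ) (n : ℕ)
    (hφ : φ.f (n + 1) = 0) :
    𝟙 (P.X (n + 1)) =
      P.d (n + 1) n ≫ h.hom n (n + 1) + h.hom (n + 1) (n + 2) ≫ P.d (n + 2) (n + 1) := by
  have h1 := h.comm (n + 1)
  rw [Homotopy.dNext_succ_chainComplex, Homotopy.prevD_chainComplex, hφ, add_zero] at h1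
  exact h1

/-- An additive functor `T` which preserves epimorphisms takes the inclusion of the boundaries to a
split monomorphism if the identity of `T(P)` is homotopic to a map which vanishes in that degree. -/
lemma isSplitMono_map_fromOpcycles (T : A ⥤ B) [T.Additive] [T.PreservesEpimorphisms]
    (P : ChainComplex A ℕ) (n : ℕ) {φ : (T.mapHomologicalComplex _).obj P ⟶ _}
    (h : Homotopy (𝟙 _) φ) (hφ : φ.f (n + 1) = 0) :
    IsSplitMono (T.map (P.fromOpcycles (n + 1) n)) := by
  let σ : T.obj (P.X n) ⟶ T.obj (P.X (n + 1)) := h.hom n (n + 1)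
  let τ : T.obj (P.X (n + 1)) ⟶ T.obj (P.X (n + 2)) := h.hom (n + 1) (n + 2)
  have h1 : 𝟙 (T.obj (P.X (n + 1))) = T.map (P.d (n + 1) n) ≫ σ + τ ≫ T.map (P.d (n + 2) (n + 1)) :=
    homotopy_id_comm_succ h n hφ
  have h2 : T.map (P.d (n + 2) (n + 1)) ≫ T.map (P.pOpcycles (n + 1)) = 0 := by
    rw [← T.map_comp, HomologicalComplex.d_pOpcycles, T.map_zero]
  -- The homotopy component `σ` retracts the differential up to boundaries, and these die in
  -- `opcycles`. The identity is checked after the epimorphism `T.map (P.pOpcycles (n + 1))`.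
  refine ⟨⟨⟨σ ≫ T.map (P.pOpcycles (n + 1)), ?_⟩⟩⟩
  rw [← cancel_epi (T.map (P.pOpcycles (n + 1))), ← Functor.map_comp_assoc,
    HomologicalComplex.p_fromOpcycles, Category.comp_id]
  calc T.map (P.d (n + 1) n) ≫ σ ≫ T.map (P.pOpcycles (n + 1))
      = (T.map (P.d (n + 1) n) ≫ σ + τ ≫ T.map (P.d (n + 2) (n + 1))) ≫
          T.map (P.pOpcycles (n + 1)) := by
        rw [Preadditive.add_comp, Category.assoc, Category.assoc, h2, Limits.comp_zero, add_zero]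
    _ = T.map (P.pOpcycles (n + 1)) := by rw [← h1, Category.id_comp]

lemma isZero_map_opcycles_zero (T : A ⥤ B) [T.Additive] [T.PreservesEpimorphisms]
    (P : ChainComplex A ℕ) {φ : (T.mapHomologicalComplex _).obj P ⟶ _}
    (h : Homotopy (𝟙 _) φ) (hφ : φ.f 0 = 0) : Limits.IsZero (T.obj (P.opcycles 0)) := by
  let τ : T.obj (P.X 0) ⟶ T.obj (P.X 1) := h.hom 0 1
  have h1 : 𝟙 (T.obj (P.X 0)) = τ ≫ T.map (P.d 1 0) := homotopy_id_comm_zero h hφ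
  have h2 : T.map (P.d 1 0) ≫ T.map (P.pOpcycles 0) = 0 := by
    rw [← T.map_comp, HomologicalComplex.d_pOpcycles, T.map_zero]
  rw [Limits.IsZero.iff_id_eq_zero, ← cancel_epi (T.map (P.pOpcycles 0)), Category.comp_id,
    Limits.comp_zero, ← Category.id_comp (T.map (P.pOpcycles 0)), h1, Category.assoc, h2,
    Limits.comp_zero]

/-- If the inclusion of the boundaries splits, then the cokernel of the differential is
projective. -/
lemma projective_opcycles_of_isSplitMono (P : ChainComplex A ℕ) (n : ℕ) [Projective (P.X n)]
    [IsSplitMono (P.fromOpcycles (n + 1) n)] : Projective (P.opcycles n) := by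
  let i := P.fromOpcycles (n + 1) n
  have hi : i ≫ P.pOpcycles n = 0 := by
    rw [← cancel_epi (P.pOpcycles (n + 1)), HomologicalComplex.p_fromOpcycles_assoc,
      HomologicalComplex.d_pOpcycles, Limits.comp_zero]
  have hd : P.d (n + 1) n ≫ (𝟙 _ - retraction i ≫ i) = 0 := by
    rw [Preadditive.comp_sub, Category.comp_id, ← HomologicalComplex.p_fromOpcycles,
      Category.assoc, IsSplitMono.id_assoc, sub_self]
  -- The projector complementary to the split image kills boundaries, so it descends to a section of
  -- `P.pOpcycles n`.
  let r : Retract (P.opcycles n) (P.X n) :=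
    { i := P.descOpcycles (𝟙 _ - retraction i ≫ i) (n + 1) (by simp) hd
      r := P.pOpcycles n
      retract := by
        rw [← cancel_epi (P.pOpcycles n), HomologicalComplex.p_descOpcycles_assoc,
          Preadditive.sub_comp, Category.assoc, hi, Limits.comp_zero, sub_zero, Category.id_comp,
          Category.comp_id] }
  exact r.projective

lemma isZero_of_isZero_opcycles {Z : A} (P : ProjectiveResolution Z)
    (h : Limits.IsZero (P.complex.opcycles 0)) : Limits.IsZero Z := by
  have h1 : P.π.f 0 = 0 := by
    rw [← P.complex.p_descOpcycles (P.π.f 0) 1 (by simp) P.complex_d_comp_π_f_zero,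
      h.eq_of_tgt (P.complex.pOpcycles 0) 0, Limits.zero_comp]
  have h2 : Limits.IsZero (((ChainComplex.single₀ A).obj Z).X 0) :=
    Limits.IsZero.of_epi_eq_zero (P.π.f 0) h1
  exact h2

lemma exists_projectiveResolution_of_isZero {Z : A} (h : Limits.IsZero Z) :
    ∃ P : ProjectiveResolution Z, complexLength P.complex < (0 : ℕ) := by
  have : Projective Z := h.projective
  refine ⟨ProjectiveResolution.self Z, complexLength_lt_of_isZero fun n _ => ?_⟩
  cases n with
  | zero => exact h
  | succ n => exact HomologicalComplex.isZero_single_obj_X _ _ _ _ n.succ_ne_zero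

lemma complexLength_map_le (T : A ⥤ B) [T.Additive] (P : ChainComplex A ℕ) :
    complexLength ((T.mapHomologicalComplex _).obj P) ≤ complexLength P :=
  iSup₂_le fun n hn => le_iSup₂_of_le (f := fun (n : ℕ) (_ : ¬ Limits.IsZero (P.X n)) =>
    (n : WithBot ℕ∞)) n (fun h => hn (T.map_isZero h)) le_rfl

/-- This reduces the main inequality to finite strict bounds; `N = 0` handles `b = ⊥`, and `b = ⊤`
needs nothing. -/
lemma withBot_enat_le_of_forall_lt {a b : WithBot ℕ∞} (h : ∀ N : ℕ, b < N → a < N) : a ≤ b := by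
  induction b with
  | bot =>
    have := h 0 (WithBot.bot_lt_coe _)
    induction a with
    | bot => exact le_rfl
    | coe a => exact absurd (WithBot.coe_lt_coe.1 this) not_lt_zero
  | coe b =>
    induction b with
    | top => exact le_top
    | coe n =>
      have h1 := h (n + 1) (by exact_mod_cast Nat.lt_succ_self n)
      induction a with
      | bot => exact bot_le
      | coe a =>
        have h2 : a < ((n + 1 : ℕ) : ℕ∞) := WithBot.coe_lt_coe.1 h1
        refine WithBot.coe_le_coe.2 (Order.le_of_lt_add_one ?_)
        exact_mod_cast h2

end SplitMono

/-! ### The two inequalities -/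

section Main

open Opposite

variable {R : Type u} [CommRing R] {Γ : Type u} [Group Γ] {𝓗 : SubgroupFamily Γ} [IsEI 𝓗]

instance (K : OrbitCat 𝓗) : (topRep R K).PreservesEpimorphisms where
  preserves {M N} f hf := by
    rw [Rep.epi_iff_surjective]
    intro y
    obtain ⟨y, rfl⟩ := topπ_app_surjective N (op K) y
    have h := (NatTrans.epi_iff_epi_app f).1 hf (op K)
    obtain ⟨x, rfl⟩ := (ModuleCat.epi_iff_surjective _).1 h y
    exact ⟨(topπ M).app (op K) x, rfl⟩

/-- The tops at `K` of any projective resolution of the trivial contramodule resolve the Weyl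
complex by projectives and are no longer than it. -/
lemma complexProjDim_le_bredonCohDim (K : OrbitCat 𝓗) :
    complexProjDim (weylComplex R 𝓗 K.stab) ≤ bredonCohDim R 𝓗 := by
  refine le_iInf fun P => ?_
  obtain ⟨q, hq⟩ := exists_quasiIso_topRep P K
  let Q : ComplexResolution (weylComplex R 𝓗 K.stab) :=
    { complex := ((topRep R K).mapHomologicalComplex _).obj P.complex
      projective := fun n => projective_topRep_obj K (P.complex.X n)
      π := q
      quasiIso := hq }
  exact (iInf_le (fun Q : ComplexResolution (weylComplex R 𝓗 K.stab) => complexLength Q.complex)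
    Q).trans (complexLength_map_le _ _)

/-- If the complexes of all Weyl groups have projective resolutions of length less than `N`, then so
has the trivial contramodule. -/
lemma bredonCohDim_lt_of_forall {n : ℕ} (hn : Order.krullDim (Members 𝓗) ≤ n) (N : ℕ)
    (h : ∀ K : OrbitCat 𝓗, complexProjDim (weylComplex R 𝓗 K.stab) < N) :
    bredonCohDim R 𝓗 < N := by
  let P := projectiveResolution (trivialContramodule R 𝓗)
  have hφ (K : OrbitCat 𝓗) : ∃ φ : ((topRep R K).mapHomologicalComplex _).obj P.complex ⟶ _,
      φ.f N = 0 ∧ Nonempty (Homotopy (𝟙 _) φ) := by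
    obtain ⟨q, hq⟩ := exists_quasiIso_topRep P K
    obtain ⟨Q, hQ⟩ := iInf_lt_iff.1 (h K)
    have := Q.quasiIso
    exact exists_homotopy_id_of_isZero (fun n => projective_topRep_obj K (P.complex.X n))
      Q.projective q Q.π N (isZero_of_complexLength_lt hQ)
  refine iInf_lt_iff.2 ?_
  cases N with
  | zero =>
    refine exists_projectiveResolution_of_isZero (isZero_of_isZero_opcycles P ?_)
    -- There is no differential out of degree `0`, so the zero map takes the place of the inclusion
    -- of boundaries: on tops its source is zero, so it splits, and a split zero map has zero
    -- source.
    have hs : IsSplitMono (0 : P.complex.opcycles 0 ⟶ P.complex.X 0) := by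
      refine isSplitMono_of_topRep hn _ fun K => ?_
      obtain ⟨φ, hφ, ⟨h⟩⟩ := hφ K
      exact ⟨⟨⟨0, (isZero_map_opcycles_zero (topRep R K) P.complex h hφ).eq_of_src _ _⟩⟩⟩
    rw [Limits.IsZero.iff_id_eq_zero, ← IsSplitMono.id (0 : P.complex.opcycles 0 ⟶ P.complex.X 0),
      Limits.zero_comp]
  | succ M =>
    have hs : IsSplitMono (P.complex.fromOpcycles (M + 1) M) := by
      refine isSplitMono_of_topRep hn _ fun K => ?_
      obtain ⟨φ, hφ, ⟨h⟩⟩ := hφ K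
      exact isSplitMono_map_fromOpcycles (topRep R K) P.complex M h hφ
    exact exists_projectiveResolution_complexLength_lt P M
      (projective_opcycles_of_isSplitMono P.complex M)

end Main

end BredonDim

end

theorem mainTheorem1 (Γ : Type u) [Group Γ] (R : Type u) [CommRing R]
    (𝓗 : BredonDim.SubgroupFamily Γ)
    (hlength : ∃ n : ℕ, ∀ H ∈ 𝓗.carrier, BredonDim.subgroupLength 𝓗 H ≤ n) :
    BredonDim.bredonCohDim R 𝓗 =
      ⨆ H ∈ 𝓗.carrier, BredonDim.complexProjDim (BredonDim.weylComplex R 𝓗 H) := by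
  obtain ⟨n, hn⟩ := hlength
  have hdim := BredonDim.krullDim_members_le hn
  have := BredonDim.isEI_of_krullDim_le hdim
  refine le_antisymm (BredonDim.withBot_enat_le_of_forall_lt fun N hN => ?_)
    (iSup₂_le fun H hH => BredonDim.complexProjDim_le_bredonCohDim ⟨H, hH⟩)
  exact BredonDim.bredonCohDim_lt_of_forall hdim N fun K =>
    lt_of_le_of_lt (le_iSup₂_of_le (f := fun H (_ : H ∈ 𝓗.carrier) =>
      BredonDim.complexProjDim (BredonDim.weylComplex R 𝓗 H)) K.stab K.mem le_rfl) hN
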